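/- Let $f(\lambda)=c\,|\lambda|^{-2\alpha}(1+\lambda^2)^{-\beta}$, $\lambda\in\mathbb R$, with $c>0$, $\beta>0$ (the spectral density of a fractional Riesz–Bessel motion). Let $\nu\ge 1$ be an integer, $1\le p<\infty$, $1\le q\le\infty$ with $\frac1p+\frac1q\le\frac1\nu$ (where $1/\infty=0$), and suppose $0<\alpha<\frac1{2p}$ and $\alpha+\beta>\frac12$. Put $\gamma=\frac1p-2\alpha$. Let $g:\mathbb R\to\mathbb R$ be integrable, symmetric ($g(-\lambda)=g(\lambda)$), and of class $\mathrm{Lip}(\mathbb R;q,\gamma)$, i.e. $g\in L^q(\mathbb R)$ and $\sup_{0<h\le\delta}\|g(\cdot+h)-g(\cdot)\|_{L^q}=O(\delta^{\gamma})$ as $\delta\to0^+$. For integrable $h:\mathbb R\to\mathbb R$ and $T>0$ let $W_T(h)$ be the truncated Toeplitz operator on the complex Hilbert space $L^2[0,T]$ given by $[W_T(h)u](t)=\int_0^T\widehat h(t-s)u(s)\,ds$, where $\widehat h(t)=\int_{\mathbb R}e^{i\lambda t}h(\lambda)\,d\lambda$, and let $$\Delta_{\nu,W}(T)=\left|\frac1T\,\mathrm{tr}\big[W_T(f)W_T(g)\big]^\nu-(2\pi)^{2\nu-1}\int_{\mathbb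 R}[f(\lambda)g(\lambda)]^\nu\,d\lambda\right|.$$ Then $f$ and $(fg)^\nu$ are integrable on $\mathbb R$, the operator $[W_T(f)W_T(g)]^\nu$ is of trace class for every $T>0$ (so that $\Delta_{\nu,W}(T)$ is well defined), and for every $\varepsilon>0$ $$\Delta_{\nu,W}(T)=O\big(T^{-\gamma+\varepsilon}\big)\qquad\text{as }T\to\infty .$$ -/

import Mathlib

open MeasureTheory Filter Topology Asymptotics
open scoped ENNReal NNReal

namespace TraceApprox

noncomputable section

/-! ### Traces of operators on a complex Hilbert space -/

/-- The bounded operator `A` on a complex Hilbert space has trace `τ`: for every orthonormal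
(Hilbert) basis `b` the diagonal sum `∑ ⟨A bᵢ, bᵢ⟩` converges unconditionally (hence absolutely),
and its value is `τ` whatever the basis. On a complex Hilbert space such a `τ` exists exactly
when `A` is of trace class. (Mathlib's `inner` is linear in the second variable.) -/
def HasTrace {H : Type} [NormedAddCommGroup H] [InnerProductSpace ℂ H]
    (A : H →L[ℂ] H) (τ : ℂ) : Prop :=
  ∀ (ι : Type) (b : HilbertBasis ι ℂ H), HasSum (fun i => inner ℂ (b i) (A (b i))) τ

/-- `A` is of trace class. -/
def IsTraceClass {H : Type} [NormedAddCommGroup H] [InnerProductSpace ℂ H]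
    (A : H →L[ℂ] H) : Prop :=
  ∃ τ : ℂ, HasTrace A τ

open Classical in
/-- The trace of `A` (with the default value `0` if `A` is not of trace class). -/
def opTrace {H : Type} [NormedAddCommGroup H] [InnerProductSpace ℂ H]
    (A : H →L[ℂ] H) : ℂ :=
  if h : IsTraceClass A then h.choose else 0

/-! ### Truncated Toeplitz operators -/

/-- The Fourier transform `∫ e^{iλt} f(λ) dλ`. -/
def fourierTr (f : ℝ → ℝ) (t : ℝ) : ℂ :=
  ∫ l : ℝ, Complex.exp (Complex.I * (l : ℂ) * (t : ℂ)) * (f l : ℂ)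

lemma norm_exp_mul (f : ℝ → ℝ) (t l : ℝ) :
    ‖Complex.exp (Complex.I * (l : ℂ) * (t : ℂ)) * (f l : ℂ)‖ = |f l| := by
  have h : Complex.I * (l : ℂ) * (t : ℂ) = ((l * t : ℝ) : ℂ) * Complex.I := by
    push_cast; ring
  rw [norm_mul, h, Complex.norm_exp_ofReal_mul_I, one_mul, Complex.norm_real, Real.norm_eq_abs]

lemma norm_fourierTr_le (f : ℝ → ℝ) (t : ℝ) : ‖fourierTr f t‖ ≤ ∫ l, |f l| := by
  refine (norm_integral_le_integral_norm _).trans (le_of_eq ?_)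
  exact integral_congr_ae (Eventually.of_forall fun l => norm_exp_mul f t l)

lemma continuous_fourierTr (f : ℝ → ℝ) : Continuous (fourierTr f) := by
  have hexp : ∀ t : ℝ, Continuous fun l : ℝ => Complex.exp (Complex.I * (l : ℂ) * (t : ℂ)) := by
    intro t; fun_prop
  by_cases hf : Integrable f
  · refine continuous_of_dominated (bound := fun l => |f l|) ?_ ?_ hf.abs ?_
    · intro t
      exact (hexp t).aestronglyMeasurable.mul
        (Complex.continuous_ofReal.comp_aestronglyMeasurable hf.aestronglyMeasurable)
    · intro t
      exact Eventually.of_forall fun l => (norm_exp_mul f t l).le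
    · refine Eventually.of_forall fun l => ?_
      fun_prop
  · have h0 : fourierTr f = fun _ => 0 := by
      funext t
      refine integral_undef fun hi => hf ?_
      have h2 : Integrable fun l : ℝ => Complex.exp (Complex.I * (l : ℂ) * ((-t : ℝ) : ℂ)) *
          (Complex.exp (Complex.I * (l : ℂ) * (t : ℂ)) * (f l : ℂ)) := by
        refine hi.bdd_mul (c := 1) (hexp (-t)).aestronglyMeasurable
          (Eventually.of_forall fun l => ?_)
        simpa using (norm_exp_mul (fun _ => 1) (-t) l).le
      have h3 : Integrable fun l : ℝ => (f l : ℂ) := by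
        refine h2.congr (Eventually.of_forall fun l => ?_)
        simp only
        rw [← mul_assoc, ← Complex.exp_add]
        simp
      simpa using h3.re
    rw [h0]
    exact continuous_const

/-- Lebesgue measure on `[0, T]`. -/
abbrev volT (T : ℝ) : Measure ℝ := volume.restrict (Set.Icc 0 T)

/-- The complex Hilbert space `L²[0, T]`. -/
abbrev L2T (T : ℝ) : Type := Lp ℂ 2 (volT T)

/-- The function `t ↦ ∫₀ᵀ f̂(t - s) u(s) ds`. -/
def toeplitzFun (T : ℝ) (f : ℝ → ℝ) (u : ℝ → ℂ) (t : ℝ) : ℂ :=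
  ∫ s in Set.Icc 0 T, fourierTr f (t - s) * u s

lemma integrable_kernel (T : ℝ) (f : ℝ → ℝ) (u : L2T T) (t : ℝ) :
    Integrable (fun s => fourierTr f (t - s) * u s) (volT T) := by
  have hu : Integrable (u : ℝ → ℂ) (volT T) := (Lp.memLp u).integrable (by norm_num)
  refine hu.bdd_mul (c := ∫ l, |f l|) ?_ (Eventually.of_forall fun s => norm_fourierTr_le f _)
  exact ((continuous_fourierTr f).comp (by fun_prop)).aestronglyMeasurable

lemma integral_norm_le (T : ℝ) (u : L2T T) :
    ∫ s, ‖u s‖ ∂(volT T) ≤ ‖u‖ * (volT T).real Set.univ ^ (1 / 2 : ℝ) := by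
  have h1 := eLpNorm_le_eLpNorm_mul_rpow_measure_univ (μ := volT T) (p := 1) (q := 2)
    (by norm_num) (Lp.aestronglyMeasurable u)
  have h2 : ∫ s, ‖u s‖ ∂(volT T) = (eLpNorm u 1 (volT T)).toReal := by
    rw [integral_norm_eq_lintegral_enorm (Lp.aestronglyMeasurable u), eLpNorm_one_eq_lintegral_enorm]
  have h3 : (1 / (1 : ℝ≥0∞).toReal - 1 / (2 : ℝ≥0∞).toReal) = (1 / 2 : ℝ) := by norm_num
  rw [h3] at h1
  rw [h2, Lp.norm_def, Measure.real, ENNReal.toReal_rpow, ← ENNReal.toReal_mul]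
  refine ENNReal.toReal_mono ?_ h1
  exact ENNReal.mul_ne_top (Lp.eLpNorm_ne_top u)
    (ENNReal.rpow_ne_top_of_nonneg (by norm_num) (measure_ne_top _ _))

lemma norm_toeplitzFun_le (T : ℝ) (f : ℝ → ℝ) (u : L2T T) (t : ℝ) :
    ‖toeplitzFun T f u t‖ ≤
      (∫ l, |f l|) * (‖u‖ * (volT T).real Set.univ ^ (1 / 2 : ℝ)) := by
  have hu : Integrable (u : ℝ → ℂ) (volT T) := (Lp.memLp u).integrable (by norm_num)
  have h0 : 0 ≤ ∫ l, |f l| := integral_nonneg fun _ => abs_nonneg _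
  calc ‖toeplitzFun T f u t‖ ≤ ∫ s, (∫ l, |f l|) * ‖u s‖ ∂(volT T) := by
        refine norm_integral_le_of_norm_le (hu.norm.const_mul _) (Eventually.of_forall fun s => ?_)
        rw [norm_mul]
        exact mul_le_mul_of_nonneg_right (norm_fourierTr_le f _) (norm_nonneg _)
    _ = (∫ l, |f l|) * ∫ s, ‖u s‖ ∂(volT T) := integral_const_mul _ _
    _ ≤ _ := mul_le_mul_of_nonneg_left (integral_norm_le T u) h0

lemma memLp_toeplitzFun (T : ℝ) (f : ℝ → ℝ) (u : L2T T) :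
    MemLp (toeplitzFun T f u) 2 (volT T) := by
  refine MemLp.of_bound ?_ _ (Eventually.of_forall fun t => norm_toeplitzFun_le T f u t)
  have h : AEStronglyMeasurable (fun x : ℝ × ℝ => fourierTr f (x.1 - x.2) * u x.2)
      ((volT T).prod (volT T)) := by
    refine AEStronglyMeasurable.mul ?_ ?_
    · exact ((continuous_fourierTr f).comp (by fun_prop)).aestronglyMeasurable
    · exact (Lp.aestronglyMeasurable u).comp_snd
  exact h.integral_prod_right'

/-- The `T`-truncated Toeplitz operator `W_T(f)` generated by `f`: the bounded operator on
`L²[0, T]` given by `[W_T(f) u](t) = ∫₀ᵀ f̂(t - s) u(s) ds`. -/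
def toeplitzOp (T : ℝ) (f : ℝ → ℝ) : L2T T →L[ℂ] L2T T :=
  LinearMap.mkContinuous
    { toFun := fun u => (memLp_toeplitzFun T f u).toLp (toeplitzFun T f u)
      map_add' := fun u v => by
        rw [← MemLp.toLp_add]
        refine MemLp.toLp_congr _ _ (Eventually.of_forall fun t => ?_)
        simp only [Pi.add_apply, toeplitzFun]
        rw [← integral_add (integrable_kernel T f u t) (integrable_kernel T f v t)]
        refine integral_congr_ae ?_
        filter_upwards [Lp.coeFn_add u v] with s hs
        rw [hs, Pi.add_apply, mul_add]
      map_smul' := fun a u => by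
        rw [RingHom.id_apply, ← MemLp.toLp_const_smul]
        refine MemLp.toLp_congr _ _ (Eventually.of_forall fun t => ?_)
        simp only [Pi.smul_apply, toeplitzFun]
        rw [← integral_smul]
        refine integral_congr_ae ?_
        filter_upwards [Lp.coeFn_smul a u] with s hs
        rw [hs, Pi.smul_apply, smul_eq_mul, smul_eq_mul]
        ring }
    ((volT T).real Set.univ ^ (1 / 2 : ℝ) *
      ((∫ l, |f l|) * (volT T).real Set.univ ^ (1 / 2 : ℝ)))
    (fun u => by
      have h0 : 0 ≤ ∫ l, |f l| := integral_nonneg fun _ => abs_nonneg _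
      have h := Lp.norm_le_of_ae_bound (p := 2) (μ := volT T)
        (f := (memLp_toeplitzFun T f u).toLp (toeplitzFun T f u))
        (C := (∫ l, |f l|) * (‖u‖ * (volT T).real Set.univ ^ (1 / 2 : ℝ)))
        (by positivity)
        (by
          filter_upwards [(memLp_toeplitzFun T f u).coeFn_toLp] with t ht
          rw [ht]
          exact norm_toeplitzFun_le T f u t)
      refine h.trans (le_of_eq ?_)
      have e1 : ((measureUnivNNReal (volT T) : ℝ≥0) : ℝ) = (volT T).real Set.univ := rfl
      have e2 : ((2 : ℝ≥0∞).toReal)⁻¹ = (1 / 2 : ℝ) := by norm_num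
      rw [e1, e2]
      ring)

/-- The defining formula of `W_T(f)`. -/
lemma toeplitzOp_apply (T : ℝ) (f : ℝ → ℝ) (u : L2T T) :
    toeplitzOp T f u =ᵐ[volT T] fun t => ∫ s in Set.Icc 0 T, fourierTr f (t - s) * u s :=
  (memLp_toeplitzFun T f u).coeFn_toLp

/-! ### The approximation error -/

/-- The operator `[W_T(f) W_T(g)]^ν`. -/
def toeplitzProd (ν : ℕ) (f g : ℝ → ℝ) (T : ℝ) : L2T T →L[ℂ] L2T T :=
  (toeplitzOp T f * toeplitzOp T g) ^ ν

/-- `Δ_{ν,W}(T) = |T⁻¹ tr [W_T(f) W_T(g)]^ν - (2π)^{2ν-1} ∫ [f(λ) g(λ)]^ν dλ|`. -/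
def traceError (ν : ℕ) (f g : ℝ → ℝ) (T : ℝ) : ℝ :=
  ‖(1 / (T : ℂ)) * opTrace (toeplitzProd ν f g T)
    - (((2 * Real.pi) ^ (2 * ν - 1) * ∫ l : ℝ, (f l * g l) ^ ν : ℝ) : ℂ)‖

/-! ### `L^p`-Lipschitz classes and the spectral density -/

/-- The `L^p` modulus of continuity `sup_{0 < h ≤ δ} ‖ψ(· + h) - ψ(·)‖_p`. -/
def modulus (p : ℝ≥0∞) (ψ : ℝ → ℝ) (δ : ℝ) : ℝ≥0∞ :=
  ⨆ h ∈ Set.Ioc 0 δ, eLpNorm (fun x => ψ (x + h) - ψ x) p volume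

/-- The class `Lip(ℝ; p, γ)` (used for `1 ≤ p ≤ ∞` and `0 < γ ≤ 1`): functions in `L^p(ℝ)` whose
`L^p` modulus of continuity is `O(δ^γ)` as `δ → 0+`. -/
def MemLip (p : ℝ≥0∞) (γ : ℝ) (ψ : ℝ → ℝ) : Prop :=
  MemLp ψ p volume ∧
    ∃ C : ℝ≥0, ∀ᶠ δ : ℝ in 𝓝[>] 0, modulus p ψ δ ≤ C * ENNReal.ofReal (δ ^ γ)

/-- The spectral density `c |λ|^{-2α} (1 + λ²)^{-β}` of a fractional Riesz-Bessel motion. -/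
def rieszBessel (c α β : ℝ) (l : ℝ) : ℝ :=
  c * |l| ^ (-2 * α) * (1 + l ^ 2) ^ (-β)

end

end TraceApprox

namespace TraceApprox

/-! Write e_l for the character t ↦ e^{ilt} in L²[0, T]. In the weak sense W_T(h) = ∫ h(l) e_l ⊗
e_l* dl (`inner_toeplitzOp`), while Plancherel gives ∫ e_l ⊗ e_l* dl = 2π·Id
(`integral_inner_mul_inner`). The first formula yields tr(W_T(h) B) = ∫ h(l) ⟨e_l, B e_l⟩ dl for
every bounded B (`hasTrace_toeplitzOp_mul`). So the trace in question is ∫ f(x) ⟨e_x, W_T(g) W_T(f)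
⋯ W_T(g) e_x⟩ dx with 2ν - 1 operators inside.

Now replace these operators one at a time, from the left, by the scalars 2π g(x), 2π f(x), …. When
all are gone, ⟨e_x, e_x⟩ = T remains, which produces the main term (2π)^{2ν-1} T ∫ (fg)^ν. By
Parseval, replacing W_T(h) costs ∫ (h(l) - h(x)) ⟨e_x, e_l⟩ ⟨e_l, v⟩ dl, where v is the image of e_x
under the operators not yet replaced.

To bound this cost, dominate each inner product of characters by the Dirichlet majorant k_T(u) =
4T/(1 + T|u|). Hölder's inequality at fixed frequency differences separates the L^p norms of the
symbols from an iterated convolution of k_T (`lintegral_mul_majorantKernel_le`). The increment of h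
contributes |u|^γ, and what is left is ∫ k_T(u) |u|^γ k_T^{*m}(u) du = O(T^{1-γ})
(`exists_lintegral_dirichlet_rpow_le`). Division by T gives O(T^{-γ}), without any ε.

Hölder needs the reciprocal exponents to sum to exactly 1, so p is lowered to ρ with 1/ρ + 1/q =
1/ν. The spectral density has L^ρ increments of order 1/ρ - 2α ≥ γ, by comparison with a dilated
fixed profile (`exists_eLpNorm_rieszBessel_increment_le`). -/

/-- Distinct orthonormal vectors are √2 apart, so balls of radius 1/2 around them are disjoint.
Countability permits the exchange of basis sum and integral in the trace formula. -/
lemma Orthonormal.countable_index {ι H : Type*} [NormedAddCommGroup H] [InnerProductSpace ℂ H]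
    [TopologicalSpace.SeparableSpace H] {b : ι → H} (hb : Orthonormal ℂ b) : Countable ι := by
  have hd : Pairwise fun i j => Disjoint (Metric.ball (b i) (1 / 2)) (Metric.ball (b j) (1 / 2)) := by
    intro i j hij
    apply Metric.ball_disjoint_ball
    have h1 : ‖b i - b j‖ ^ 2 = 2 := by
      rw [@norm_sub_sq ℂ, hb.1 i, hb.1 j, hb.2 hij]
      norm_num
    rw [dist_eq_norm]
    nlinarith [norm_nonneg (b i - b j)]
  exact hd.countable_of_isOpen_disjoint (fun i => Metric.isOpen_ball)
    (fun i => ⟨b i, Metric.mem_ball_self (by norm_num)⟩)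

/-! ### Characters on [0, T] and their inner products -/

lemma memLp_exp (T l : ℝ) :
    MemLp (fun t : ℝ => Complex.exp (Complex.I * (l : ℂ) * (t : ℂ))) 2 (volT T) := by
  refine MemLp.of_bound (C := 1) (Continuous.aestronglyMeasurable (by fun_prop))
    (Eventually.of_forall fun t => ?_)
  simpa using (norm_exp_mul (fun _ => 1) t l).le

/-- The character `t ↦ e^{ilt}` as an element of `L²[0, T]`. -/
noncomputable def expVec (T l : ℝ) : L2T T := (memLp_exp T l).toLp _

lemma coeFn_expVec (T l : ℝ) :
    expVec T l =ᵐ[volT T] fun t => Complex.exp (Complex.I * (l : ℂ) * (t : ℂ)) :=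
  (memLp_exp T l).coeFn_toLp

lemma conj_exp_I_mul (l t : ℝ) : (starRingEnd ℂ) (Complex.exp (Complex.I * (l : ℂ) * (t : ℂ))) =
    Complex.exp (-(Complex.I * (l : ℂ) * (t : ℂ))) := by
  rw [← Complex.exp_conj]
  simp

lemma inner_expVec_left (T l : ℝ) (v : L2T T) : inner ℂ (expVec T l) v =
    ∫ t in Set.Icc 0 T, Complex.exp (-(Complex.I * (l : ℂ) * (t : ℂ))) * v t := by
  rw [L2.inner_def]
  refine integral_congr_ae ?_
  filter_upwards [coeFn_expVec T l] with t ht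
  rw [ht, RCLike.inner_apply, conj_exp_I_mul, mul_comm]

lemma inner_expVec_expVec (T l m : ℝ) : inner ℂ (expVec T l) (expVec T m) =
    ∫ t in Set.Icc 0 T, Complex.exp (Complex.I * ((m - l : ℝ) : ℂ) * (t : ℂ)) := by
  rw [inner_expVec_left]
  refine integral_congr_ae ?_
  filter_upwards [coeFn_expVec T m] with t ht
  rw [ht, ← Complex.exp_add]
  push_cast
  ring_nf

lemma norm_expVec_sq {T : ℝ} (hT : 0 ≤ T) (l : ℝ) : ‖expVec T l‖ ^ 2 = T := by
  have h := inner_expVec_expVec T l l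
  rw [inner_self_eq_norm_sq_to_K] at h
  have h2 : ((‖expVec T l‖ ^ 2 : ℝ) : ℂ) = (T : ℂ) := by
    push_cast
    rw [← Complex.coe_algebraMap] at *
    rw [h]
    simp [hT]
  exact_mod_cast h2

lemma inner_expVec_self {T : ℝ} (hT : 0 ≤ T) (l : ℝ) :
    inner ℂ (expVec T l) (expVec T l) = (T : ℂ) := by
  rw [inner_self_eq_norm_sq_to_K]
  exact (Complex.ofReal_pow _ _).symm.trans (congrArg _ (norm_expVec_sq hT l))

lemma norm_expVec {T : ℝ} (hT : 0 ≤ T) (l : ℝ) : ‖expVec T l‖ = √T := by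
  rw [eq_comm, Real.sqrt_eq_iff_eq_sq hT (norm_nonneg _), norm_expVec_sq hT l]

lemma norm_inner_expVec_le_div {T : ℝ} (hT : 0 ≤ T) {l m : ℝ} (h : l ≠ m) :
    ‖inner ℂ (expVec T l) (expVec T m)‖ ≤ 2 / |l - m| := by
  have hne : Complex.I * ((m - l : ℝ) : ℂ) ≠ 0 :=
    mul_ne_zero Complex.I_ne_zero (by exact_mod_cast sub_ne_zero.2 h.symm)
  rw [inner_expVec_expVec, integral_Icc_eq_integral_Ioc, ← intervalIntegral.integral_of_le hT,
    integral_exp_mul_complex hne, norm_div]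
  have e : ‖Complex.I * ((m - l : ℝ) : ℂ)‖ = |l - m| := by
    rw [norm_mul, Complex.norm_I, one_mul, Complex.norm_real, Real.norm_eq_abs, abs_sub_comm]
  rw [e]
  gcongr
  refine (norm_sub_le _ _).trans ?_
  have h1 := norm_exp_mul (fun _ => 1) T (m - l)
  have h2 := norm_exp_mul (fun _ => 1) 0 (m - l)
  simp only [Complex.ofReal_one, mul_one, abs_one] at h1 h2
  rw [h1, h2]
  norm_num

lemma norm_inner_expVec_le {T : ℝ} (hT : 0 < T) (l m : ℝ) :
    ‖inner ℂ (expVec T l) (expVec T m)‖ ≤ 4 * (T / (1 + T * |l - m|)) := by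
  have h0 : ‖inner ℂ (expVec T l) (expVec T m)‖ ≤ T := by
    refine (norm_inner_le_norm _ _).trans (le_of_eq ?_)
    rw [norm_expVec hT.le, norm_expVec hT.le, Real.mul_self_sqrt hT.le]
  have hpos : 0 < 1 + T * |l - m| := by positivity
  by_cases hc : T * |l - m| ≤ 1
  · refine h0.trans ?_
    rw [← mul_div_assoc, le_div_iff₀ hpos]
    nlinarith
  · push Not at hc
    have hne : l ≠ m := by
      rintro rfl
      simp at hc
      linarith
    have hp : 0 < |l - m| := abs_pos.2 (sub_ne_zero.2 hne)
    refine (norm_inner_expVec_le_div hT.le hne).trans ?_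
    rw [← mul_div_assoc, div_le_div_iff₀ hp hpos]
    nlinarith

/-- Expanding the square, ‖e_m - e_l‖² = 2T - 2 Re ∫ e^{i(l-m)t} dt, which is continuous in m and
vanishes at m = l. -/
lemma continuous_expVec {T : ℝ} (hT : 0 ≤ T) : Continuous (expVec T) := by
  have hc : Continuous fun x : ℝ => ∫ t in Set.Icc 0 T, Complex.exp (Complex.I * (x : ℂ) * (t : ℂ)) := by
    refine continuous_of_dominated (bound := fun _ => 1)
      (fun x => Continuous.aestronglyMeasurable (by fun_prop))
      (fun x => Eventually.of_forall fun t => ?_) (integrable_const _)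
      (Eventually.of_forall fun t => by fun_prop)
    simpa using (norm_exp_mul (fun _ => 1) t x).le
  rw [continuous_iff_continuousAt]
  intro l
  rw [ContinuousAt, tendsto_iff_norm_sub_tendsto_zero]
  have h2 : Tendsto (fun m : ℝ => ‖expVec T m - expVec T l‖ ^ 2) (𝓝 l) (𝓝 0) := by
    have e : ∀ m, ‖expVec T m - expVec T l‖ ^ 2 = 2 * T - 2 * (∫ t in Set.Icc 0 T,
        Complex.exp (Complex.I * ((l - m : ℝ) : ℂ) * (t : ℂ))).re := by
      intro m
      rw [@norm_sub_sq ℂ, norm_expVec_sq hT, norm_expVec_sq hT, inner_expVec_expVec]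
      simp only [RCLike.re_to_complex]
      ring
    simp_rw [e]
    have h3 : Continuous fun m : ℝ => 2 * T - 2 * (∫ t in Set.Icc 0 T,
        Complex.exp (Complex.I * ((l - m : ℝ) : ℂ) * (t : ℂ))).re := by
      have := hc.comp (continuous_const.sub continuous_id : Continuous fun m : ℝ => l - m)
      exact continuous_const.sub (continuous_const.mul (Complex.continuous_re.comp this))
    have h4 := h3.tendsto l
    convert h4 using 2
    simp [hT]
  have h5 := h2.sqrt
  simpa [Real.sqrt_sq (norm_nonneg _)] using h5

/-! ### Plancherel for functions supported in [0, T] -/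

/-- The `L²` Fourier transform of an integrable `L²` function is given by the Fourier integral. -/
lemma coeFn_fourier_toLp {v : ℝ → ℂ} (h1 : Integrable v) (h2 : MemLp v 2 volume) :
    (FourierTransform.fourier (h2.toLp v) : Lp ℂ 2 (volume : Measure ℝ)) =ᵐ[volume]
      (FourierTransform.fourier v : ℝ → ℂ) := by
  have hcont : Continuous (FourierTransform.fourier v : ℝ → ℂ) :=
    VectorFourier.fourierIntegral_continuous Real.continuous_fourierChar (by fun_prop) h1
  have hL : LocallyIntegrable
      (FourierTransform.fourier (h2.toLp v) : Lp ℂ 2 (volume : Measure ℝ)) volume :=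
    (Lp.memLp _).locallyIntegrable (by norm_num)
  -- Both sides are locally integrable, so it suffices to test against smooth compactly supported φ.
  -- There the distributional Fourier transform moves onto φ, and Fubini moves it back onto v.
  have key := ae_eq_zero_of_integral_contDiff_smul_eq_zero (μ := (volume : Measure ℝ))
    (hL.sub hcont.locallyIntegrable) ?_
  · filter_upwards [key] with x hx
    exact sub_eq_zero.1 hx
  intro φ φs φc
  have hg₁ : HasCompactSupport (Complex.ofRealCLM ∘ φ) := φc.comp_left rfl
  have hg₂ : ContDiff ℝ ((⊤ : ℕ∞) : WithTop ℕ∞) (Complex.ofRealCLM ∘ φ) := by fun_prop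
  have hT := congrArg (fun F => F (hg₁.toSchwartzMap hg₂))
    (Lp.fourier_toTemperedDistribution_eq (h2.toLp v))
  simp only [TemperedDistribution.fourier_apply, Lp.toTemperedDistribution_apply] at hT
  have e1 : ∫ x, (FourierTransform.fourier (hg₁.toSchwartzMap hg₂) : SchwartzMap ℝ ℂ) x •
      (h2.toLp v) x = ∫ x, (φ x) • (FourierTransform.fourier v : ℝ → ℂ) x := by
    have e2 := VectorFourier.integral_fourierIntegral_smul_eq_flip (L := innerₗ ℝ)
      Real.continuous_fourierChar (by fun_prop) (hg₁.toSchwartzMap hg₂).integrable h1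
      (μ := volume) (ν := volume)
    calc _ = ∫ ξ, VectorFourier.fourierIntegral Real.fourierChar volume (innerₗ ℝ)
              (hg₁.toSchwartzMap hg₂) ξ • v ξ := by
          refine integral_congr_ae ?_
          filter_upwards [h2.coeFn_toLp] with x hx
          rw [hx]
          rfl
      _ = _ := by
          rw [e2]
          refine integral_congr_ae (Eventually.of_forall fun x => ?_)
          simp only [flip_innerₗ, Real.fourier_eq]
          simp [VectorFourier.fourierIntegral]
  rw [e1] at hT
  have hi1 : Integrable fun x => φ x •
      (FourierTransform.fourier (h2.toLp v) : Lp ℂ 2 (volume : Measure ℝ)) x :=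
    hL.integrable_smul_left_of_hasCompactSupport φs.continuous φc
  have hi2 : Integrable fun x => φ x • (FourierTransform.fourier v : ℝ → ℂ) x :=
    hcont.locallyIntegrable.integrable_smul_left_of_hasCompactSupport φs.continuous φc
  simp only [Pi.sub_apply, smul_sub]
  rw [integral_sub hi1 hi2, sub_eq_zero, hT]
  simp

/-- The extension by zero of an element of `L²[0, T]`. -/
noncomputable def extendZero {T : ℝ} (v : L2T T) : ℝ → ℂ := (Set.Icc 0 T).indicator v

lemma memLp_extendZero {T : ℝ} (v : L2T T) : MemLp (extendZero v) 2 volume :=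
  (memLp_indicator_iff_restrict measurableSet_Icc).2 (Lp.memLp v)

lemma integrable_extendZero {T : ℝ} (v : L2T T) : Integrable (extendZero v) volume :=
  (integrable_indicator_iff measurableSet_Icc).2 ((Lp.memLp v).integrable (by norm_num))

lemma fourier_extendZero {T : ℝ} (v : L2T T) (w : ℝ) :
    (FourierTransform.fourier (extendZero v) : ℝ → ℂ) w =
      inner ℂ (expVec T (2 * Real.pi * w)) v := by
  rw [inner_expVec_left, Real.fourier_eq', ← integral_indicator measurableSet_Icc]
  refine integral_congr_ae (Eventually.of_forall fun t => ?_)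
  by_cases ht : t ∈ Set.Icc 0 T
  · simp only [extendZero, Set.indicator_of_mem ht, smul_eq_mul]
    congr 2
    simp
    ring
  · simp [extendZero, Set.indicator_of_notMem ht]

lemma inner_toLp_extendZero {T : ℝ} (u v : L2T T) :
    inner ℂ ((memLp_extendZero u).toLp _) ((memLp_extendZero v).toLp _) = inner ℂ u v := by
  rw [L2.inner_def, L2.inner_def, ← integral_indicator measurableSet_Icc]
  refine integral_congr_ae ?_
  filter_upwards [(memLp_extendZero u).coeFn_toLp, (memLp_extendZero v).coeFn_toLp] with t h1 h2
  rw [h1, h2]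
  by_cases ht : t ∈ Set.Icc 0 T
  · simp [extendZero, Set.indicator_of_mem ht]
  · simp [extendZero, Set.indicator_of_notMem ht]

lemma ae_inner_fourier {T : ℝ} (u v : L2T T) :
    (fun w => inner ℂ ((FourierTransform.fourier ((memLp_extendZero u).toLp _) :
        Lp ℂ 2 (volume : Measure ℝ)) w)
      ((FourierTransform.fourier ((memLp_extendZero v).toLp _) : Lp ℂ 2 (volume : Measure ℝ)) w))
    =ᵐ[volume] fun w => (fun l => inner ℂ u (expVec T l) * inner ℂ (expVec T l) v)
      (2 * Real.pi * w) := by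
  filter_upwards [coeFn_fourier_toLp (integrable_extendZero u) (memLp_extendZero u),
    coeFn_fourier_toLp (integrable_extendZero v) (memLp_extendZero v)] with w h1 h2
  rw [h1, h2, fourier_extendZero, fourier_extendZero, RCLike.inner_apply, inner_conj_symm, mul_comm]

lemma integrable_inner_mul_inner {T : ℝ} (u v : L2T T) :
    Integrable fun l => inner ℂ u (expVec T l) * inner ℂ (expVec T l) v := by
  have h := (L2.integrable_inner (𝕜 := ℂ) (FourierTransform.fourier ((memLp_extendZero u).toLp _) :
    Lp ℂ 2 (volume : Measure ℝ)) (FourierTransform.fourier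
      ((memLp_extendZero v).toLp _))).congr (ae_inner_fourier u v)
  exact (integrable_comp_mul_left_iff _ (by positivity)).1 h

/-- Parseval's formula for the characters on `[0, T]`. -/
lemma integral_inner_mul_inner {T : ℝ} (u v : L2T T) :
    ∫ l, inner ℂ u (expVec T l) * inner ℂ (expVec T l) v = 2 * Real.pi * inner ℂ u v := by
  -- The factor 2π comes from the substitution l = 2πw between the two frequency normalizations.
  have h := Lp.inner_fourier_eq ((memLp_extendZero u).toLp _) ((memLp_extendZero v).toLp _)
  rw [inner_toLp_extendZero, L2.inner_def, integral_congr_ae (ae_inner_fourier u v),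
    Measure.integral_comp_mul_left
      (fun l => inner ℂ u (expVec T l) * inner ℂ (expVec T l) v)] at h
  rw [← h, abs_of_pos (by positivity), ← Complex.coe_smul, smul_eq_mul, ← mul_assoc]
  push_cast
  rw [mul_inv_cancel₀, one_mul]
  exact mul_ne_zero two_ne_zero (by exact_mod_cast Real.pi_ne_zero)

/-! ### Toeplitz operators as integrals of rank-one operators; the trace formula -/

lemma integral_mul_integral_swap {T : ℝ} {φ : ℝ × ℝ → ℂ} (hφ : Continuous φ)
    (hb : ∀ x, ‖φ x‖ ≤ 1) {w k : ℝ → ℂ} (hw : Integrable w (volT T)) (hk : Integrable k) :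
    ∫ t in Set.Icc 0 T, w t * ∫ l, φ (t, l) * k l =
      ∫ l, k l * ∫ t in Set.Icc 0 T, φ (t, l) * w t := by
  have hi : Integrable (fun z : ℝ × ℝ => φ z * (w z.1 * k z.2)) ((volT T).prod volume) :=
    (hw.mul_prod hk).bdd_mul (c := 1) hφ.aestronglyMeasurable (Eventually.of_forall hb)
  calc _ = ∫ t in Set.Icc 0 T, ∫ l, φ (t, l) * (w t * k l) := by
        refine integral_congr_ae (Eventually.of_forall fun t => ?_)
        simp only
        rw [← integral_const_mul]
        congr 1
        ext l
        ring
    _ = ∫ l, ∫ t in Set.Icc 0 T, φ (t, l) * (w t * k l) := integral_integral_swap hi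
    _ = _ := by
        refine integral_congr_ae (Eventually.of_forall fun l => ?_)
        simp only
        rw [← integral_const_mul]
        congr 1
        ext l
        ring

lemma norm_exp_I_mul (l t : ℝ) : ‖Complex.exp (Complex.I * (l : ℂ) * (t : ℂ))‖ = 1 := by
  simpa using norm_exp_mul (fun _ => 1) t l

lemma norm_exp_neg_I_mul (l t : ℝ) : ‖Complex.exp (-(Complex.I * (l : ℂ) * (t : ℂ)))‖ = 1 := by
  rw [← conj_exp_I_mul, RCLike.norm_conj, norm_exp_I_mul]

lemma integrable_mul_inner_expVec {T : ℝ} (hT : 0 ≤ T) {h : ℝ → ℝ} (hh : Integrable h) (v : L2T T) :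
    Integrable fun l => (h l : ℂ) * inner ℂ (expVec T l) v := by
  refine hh.ofReal.mul_bdd (c := √T * ‖v‖) ?_ (Eventually.of_forall fun l => ?_)
  · exact ((continuous_expVec hT).inner continuous_const).aestronglyMeasurable
  · refine (norm_inner_le_norm _ _).trans (le_of_eq ?_)
    rw [norm_expVec hT]

lemma toeplitzOp_apply_expVec {T : ℝ} {h : ℝ → ℝ} (hh : Integrable h) (v : L2T T) :
    toeplitzOp T h v =ᵐ[volT T] fun t => ∫ l : ℝ, Complex.exp (Complex.I * (l : ℂ) * (t : ℂ)) *
      ((h l : ℂ) * inner ℂ (expVec T l) v) := by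
  filter_upwards [toeplitzOp_apply T h v] with t ht
  rw [ht]
  have h1 := integral_mul_integral_swap (T := T)
    (φ := fun x => Complex.exp (-(Complex.I * (x.2 : ℂ) * (x.1 : ℂ)))) (by fun_prop)
    (fun x => (norm_exp_neg_I_mul _ _).le) (w := v)
    (k := fun l => Complex.exp (Complex.I * (l : ℂ) * (t : ℂ)) * (h l : ℂ))
    ((Lp.memLp v).integrable (by norm_num))
    (hh.ofReal.bdd_mul (c := 1) (Continuous.aestronglyMeasurable (by fun_prop))
      (Eventually.of_forall fun l => (norm_exp_I_mul l t).le))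
  calc _ = ∫ s in Set.Icc 0 T, v s * ∫ l : ℝ, Complex.exp (-(Complex.I * (l : ℂ) * (s : ℂ))) *
        (Complex.exp (Complex.I * (l : ℂ) * (t : ℂ)) * (h l : ℂ)) := by
        refine integral_congr_ae (Eventually.of_forall fun s => ?_)
        simp only [fourierTr]
        rw [mul_comm]
        congr 2
        ext l
        rw [← mul_assoc, ← Complex.exp_add]
        push_cast
        ring_nf
    _ = _ := h1
    _ = _ := by
        simp only [inner_expVec_left, mul_assoc]

/-- The weak form of W_T(h) = ∫ h(l) e_l ⊗ e_l* dl, obtained by two applications of Fubini. The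
trace formula and the kernel bounds both rest on it. -/
lemma inner_toeplitzOp {T : ℝ} (hT : 0 ≤ T) {h : ℝ → ℝ} (hh : Integrable h) (u v : L2T T) :
    inner ℂ u (toeplitzOp T h v) =
      ∫ l, (h l : ℂ) * (inner ℂ u (expVec T l) * inner ℂ (expVec T l) v) := by
  have hu : Integrable (fun t => (starRingEnd ℂ) (u t)) (volT T) :=
    
    ((ContinuousLinearEquiv.integrable_comp_iff Complex.conjCLE).2
      ((Lp.memLp u).integrable (by norm_num)))
  have h1 := integral_mul_integral_swap (T := T)
    (φ := fun x => Complex.exp (Complex.I * (x.2 : ℂ) * (x.1 : ℂ))) (by fun_prop)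
    (fun x => (norm_exp_I_mul _ _).le) hu (integrable_mul_inner_expVec hT hh v)
  rw [L2.inner_def]
  calc _ = ∫ t in Set.Icc 0 T, (starRingEnd ℂ) (u t) * ∫ l : ℝ,
        Complex.exp (Complex.I * (l : ℂ) * (t : ℂ)) * ((h l : ℂ) * inner ℂ (expVec T l) v) := by
        refine integral_congr_ae ?_
        filter_upwards [toeplitzOp_apply_expVec hh v] with t ht
        rw [ht, RCLike.inner_apply, mul_comm]
    _ = _ := h1
    _ = _ := by
        refine integral_congr_ae (Eventually.of_forall fun l => ?_)
        have e : inner ℂ u (expVec T l) =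
            ∫ t in Set.Icc 0 T, Complex.exp (Complex.I * (l : ℂ) * (t : ℂ)) *
              (starRingEnd ℂ) (u t) := by
          rw [L2.inner_def]
          refine integral_congr_ae ?_
          filter_upwards [coeFn_expVec T l] with t ht
          rw [ht, RCLike.inner_apply]
        simp only [← e]
        ring

/-- The operator `W_T(h) B`, with `h` integrable and `B` bounded, has a trace. -/
lemma hasTrace_toeplitzOp_mul {T : ℝ} (hT : 0 ≤ T) {h : ℝ → ℝ} (hh : Integrable h)
    (B : L2T T →L[ℂ] L2T T) :
    HasTrace (toeplitzOp T h * B) (∫ l, (h l : ℂ) * inner ℂ (expVec T l) (B (expVec T l))) := by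
  intro ι b
  have : Fact ((2 : ℝ≥0∞) ≠ ∞) := ⟨by norm_num⟩
  have hcount : Countable ι := Orthonormal.countable_index b.orthonormal
  set F : ι → ℝ → ℂ := fun i l =>
    (h l : ℂ) * (inner ℂ (b i) (expVec T l) * inner ℂ (expVec T l) (B (b i))) with hF
  have hcm : ∀ i, Continuous fun l => inner ℂ (b i) (expVec T l) * inner ℂ (expVec T l) (B (b i)) :=
    fun i => (continuous_const.inner (continuous_expVec hT)).mul
      ((continuous_expVec hT).inner continuous_const)
  have hadj : ∀ l i, inner ℂ (expVec T l) (B (b i)) =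
      inner ℂ (ContinuousLinearMap.adjoint B (expVec T l)) (b i) := fun l i =>
    (ContinuousLinearMap.adjoint_inner_left B (b i) (expVec T l)).symm
  have hint : ∀ i, Integrable (F i) := by
    intro i
    refine hh.ofReal.mul_bdd (c := √T * (√T * ‖B (b i)‖)) (hcm i).aestronglyMeasurable
      (Eventually.of_forall fun l => ?_)
    rw [norm_mul]
    refine mul_le_mul ?_ ?_ (norm_nonneg _) (Real.sqrt_nonneg _)
    · refine (norm_inner_le_norm _ _).trans (le_of_eq ?_)
      rw [norm_expVec hT, b.orthonormal.1 i, one_mul]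
    · refine (norm_inner_le_norm _ _).trans (le_of_eq ?_)
      rw [norm_expVec hT]
  -- Bessel's inequality for e_l and for B* e_l, together with ab ≤ a² + b², bounds every partial
  -- sum by ∫ |h| (T + ‖B*‖² T).
  have hsum : Summable fun i => ∫ l, ‖F i l‖ := by
    refine summable_of_sum_le (c := ∫ l, |h l| * (T + ‖ContinuousLinearMap.adjoint B‖ ^ 2 * T))
      (fun i => integral_nonneg fun l => norm_nonneg _) (fun s => ?_)
    rw [← integral_finsetSum _ (fun i _ => (hint i).norm)]
    refine integral_mono (integrable_finsetSum _ fun i _ => (hint i).norm)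
      (hh.abs.mul_const _) (fun l => ?_)
    simp only [hF, norm_mul, Complex.norm_real, Real.norm_eq_abs]
    rw [← Finset.mul_sum]
    refine mul_le_mul_of_nonneg_left ?_ (abs_nonneg _)
    have hB1 : ∑ i ∈ s, ‖inner ℂ (b i) (expVec T l)‖ ^ 2 ≤ T := by
      have := b.orthonormal.sum_inner_products_le (x := expVec T l) (s := s)
      rwa [norm_expVec_sq hT] at this
    have hB2 : ∑ i ∈ s, ‖inner ℂ (b i) (ContinuousLinearMap.adjoint B (expVec T l))‖ ^ 2 ≤
        ‖ContinuousLinearMap.adjoint B‖ ^ 2 * T := by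
      refine (b.orthonormal.sum_inner_products_le
        (x := ContinuousLinearMap.adjoint B (expVec T l)) (s := s)).trans ?_
      refine le_of_le_of_eq ?_ (congrArg _ (norm_expVec_sq hT l))
      rw [← mul_pow]
      gcongr
      exact ContinuousLinearMap.le_opNorm _ _
    refine le_trans ?_ (add_le_add hB1 hB2)
    rw [← Finset.sum_add_distrib]
    refine Finset.sum_le_sum fun i _ => ?_
    rw [hadj, norm_inner_symm (ContinuousLinearMap.adjoint B (expVec T l)) (b i)]
    nlinarith [sq_nonneg (‖inner ℂ (b i) (expVec T l)‖ -
      ‖inner ℂ (b i) (ContinuousLinearMap.adjoint B (expVec T l))‖),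
      sq_nonneg ‖inner ℂ (b i) (expVec T l)‖,
      sq_nonneg ‖inner ℂ (b i) (ContinuousLinearMap.adjoint B (expVec T l))‖]
  have key := hasSum_integral_of_summable_integral_norm hint hsum
  convert! key using 1
  · funext i
    exact inner_toeplitzOp hT hh _ _
  · refine integral_congr_ae (Eventually.of_forall fun l => ?_)
    simp only [hF]
    rw [tsum_mul_left]
    congr 1
    have := b.tsum_inner_mul_inner (ContinuousLinearMap.adjoint B (expVec T l)) (expVec T l)
    rw [← ContinuousLinearMap.adjoint_inner_left, ← this]
    refine tsum_congr fun i => ?_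
    rw [hadj, mul_comm]

lemma HasTrace.opTrace_eq {H : Type} [NormedAddCommGroup H] [InnerProductSpace ℂ H]
    [CompleteSpace H] {A : H →L[ℂ] H} {τ : ℂ} (h : HasTrace A τ) : opTrace A = τ := by
  have hA : IsTraceClass A := ⟨τ, h⟩
  obtain ⟨w, b, -⟩ := exists_hilbertBasis ℂ H
  rw [opTrace, dif_pos hA]
  exact (hA.choose_spec w b).unique (h w b)

/-! ### The Dirichlet majorant and its iterated convolutions -/

lemma lintegral_comp_mul_left_real {F : ℝ → ℝ≥0∞} (hF : Measurable F) {T : ℝ} (hT : 0 < T) :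
    ∫⁻ u, F (T * u) = ENNReal.ofReal T⁻¹ * ∫⁻ u, F u := by
  rw [← lintegral_map hF (measurable_const_mul T), Real.map_volume_mul_left hT.ne',
    lintegral_smul_measure, abs_of_pos (inv_pos.2 hT), smul_eq_mul]

lemma lintegral_one_add_abs_lt_top {r : ℝ} (hr : 1 < r) :
    ∫⁻ u : ℝ, ENNReal.ofReal ((1 + |u|) ^ (-r)) < ∞ := by
  have h := finite_integral_one_add_norm (E := ℝ) (μ := volume) (r := r) (by simpa using hr)
  simpa [Real.norm_eq_abs] using h

lemma measurable_one_add_abs (r : ℝ) : Measurable fun u : ℝ => ENNReal.ofReal ((1 + |u|) ^ r) := by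
  fun_prop

/-- The smaller base can carry both exponents. This reduces integrals of weights with two centres to
integrals with one. -/
lemma rpow_neg_mul_rpow_neg_le {A B s t : ℝ} (hA : 1 ≤ A) (hB : 1 ≤ B) (hs : 0 ≤ s) (ht : 0 ≤ t) :
    A ^ (-s) * B ^ (-t) ≤ A ^ (-(s + t)) + B ^ (-(s + t)) := by
  have hA0 : 0 < A := by linarith
  have hB0 : 0 < B := by linarith
  rcases le_total A B with h | h
  · have : B ^ (-t) ≤ A ^ (-t) := Real.rpow_le_rpow_of_nonpos hA0 h (by linarith)
    calc A ^ (-s) * B ^ (-t) ≤ A ^ (-s) * A ^ (-t) := by gcongr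
      _ = A ^ (-(s + t)) := by rw [← Real.rpow_add hA0]; congr 1; ring
      _ ≤ _ := le_add_of_nonneg_right (by positivity)
  · have : A ^ (-s) ≤ B ^ (-s) := Real.rpow_le_rpow_of_nonpos hB0 h (by linarith)
    calc A ^ (-s) * B ^ (-t) ≤ B ^ (-s) * B ^ (-t) := by gcongr
      _ = B ^ (-(s + t)) := by rw [← Real.rpow_add hB0]; congr 1; ring
      _ ≤ _ := le_add_of_nonneg_left (by positivity)

lemma exists_lintegral_rpow_mul_rpow_le {s t : ℝ} (hs : 0 ≤ s) (ht : 0 ≤ t) (hst : 1 < s + t) :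
    ∃ C : ℝ≥0, ∀ x : ℝ,
      ∫⁻ u : ℝ, ENNReal.ofReal ((1 + |u|) ^ (-s) * (1 + |x + u|) ^ (-t)) ≤ C := by
  set I := ∫⁻ u : ℝ, ENNReal.ofReal ((1 + |u|) ^ (-(s + t))) with hI
  have hfin : I < ∞ := lintegral_one_add_abs_lt_top hst
  refine ⟨(I + I).toNNReal, fun x => ?_⟩
  rw [ENNReal.coe_toNNReal (ENNReal.add_lt_top.2 ⟨hfin, hfin⟩).ne]
  calc _ ≤ ∫⁻ u : ℝ, (ENNReal.ofReal ((1 + |u|) ^ (-(s + t))) +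
        ENNReal.ofReal ((1 + |x + u|) ^ (-(s + t)))) := by
        refine lintegral_mono fun u => ?_
        rw [← ENNReal.ofReal_add (by positivity) (by positivity)]
        exact ENNReal.ofReal_le_ofReal (rpow_neg_mul_rpow_neg_le (by simp) (by simp) hs ht)
    _ = I + I := by
        rw [lintegral_add_left (measurable_one_add_abs _)]
        congr 1
        exact lintegral_add_left_eq_self
          (fun u => ENNReal.ofReal ((1 + |u|) ^ (-(s + t)))) x

/-- Subadditivity of s ↦ s^c gives (1+|x|)^c ≤ (1+|u|)^c + (1+|x+u|)^c. Either term leaves total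
exponent 1 + b - c > 1, hence a bound uniform in x. The loss from b to c avoids tracking logarithms.
-/
lemma exists_lintegral_inv_mul_rpow_le {b c : ℝ} (hc : 0 ≤ c) (hcb : c < b) (hb : b ≤ 1) :
    ∃ C : ℝ≥0, ∀ x : ℝ, ∫⁻ u : ℝ, ENNReal.ofReal ((1 + |u|) ^ (-1 : ℝ) * (1 + |x + u|) ^ (-b)) ≤
      C * ENNReal.ofReal ((1 + |x|) ^ (-c)) := by
  obtain ⟨C₁, h₁⟩ := exists_lintegral_rpow_mul_rpow_le (s := 1 - c) (t := b)
    (by linarith) (by linarith) (by linarith)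
  obtain ⟨C₂, h₂⟩ := exists_lintegral_rpow_mul_rpow_le (s := 1) (t := b - c)
    (by linarith) (by linarith) (by linarith)
  refine ⟨C₁ + C₂, fun x => ?_⟩
  have hpt : ∀ u : ℝ, (1 + |u|) ^ (-1 : ℝ) * (1 + |x + u|) ^ (-b) ≤
      ((1 + |u|) ^ (-(1 - c)) * (1 + |x + u|) ^ (-b) +
        (1 + |u|) ^ (-1 : ℝ) * (1 + |x + u|) ^ (-(b - c))) * (1 + |x|) ^ (-c) := by
    intro u
    have hA : 0 < 1 + |u| := by positivity
    have hB : 0 < 1 + |x + u| := by positivity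
    have hX : 0 < 1 + |x| := by positivity
    have h3 : (1 + |x|) ^ c ≤ (1 + |u|) ^ c + (1 + |x + u|) ^ c := by
      refine le_trans ?_ (Real.rpow_add_le_add_rpow hA.le hB.le hc (by linarith))
      refine Real.rpow_le_rpow hX.le ?_ hc
      have : |x| ≤ |x + u| + |u| := by
        have := abs_sub (x + u) u
        simpa using this
      linarith
    have e1 : (1 + |u|) ^ (-(1 - c)) = (1 + |u|) ^ (-1 : ℝ) * (1 + |u|) ^ c := by
      rw [← Real.rpow_add hA]; congr 1; ring
    have e2 : (1 + |x + u|) ^ (-(b - c)) = (1 + |x + u|) ^ (-b) * (1 + |x + u|) ^ c := by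
      rw [← Real.rpow_add hB]; congr 1; ring
    rw [e1, e2, Real.rpow_neg hX.le c, ← div_eq_mul_inv, le_div_iff₀ (by positivity)]
    calc (1 + |u|) ^ (-1 : ℝ) * (1 + |x + u|) ^ (-b) * (1 + |x|) ^ c
        ≤ (1 + |u|) ^ (-1 : ℝ) * (1 + |x + u|) ^ (-b) * ((1 + |u|) ^ c + (1 + |x + u|) ^ c) := by
          gcongr
      _ = _ := by ring
  calc _ ≤ ∫⁻ u : ℝ, (ENNReal.ofReal ((1 + |u|) ^ (-(1 - c)) * (1 + |x + u|) ^ (-b)) +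
        ENNReal.ofReal ((1 + |u|) ^ (-1 : ℝ) * (1 + |x + u|) ^ (-(b - c)))) *
          ENNReal.ofReal ((1 + |x|) ^ (-c)) := by
        refine lintegral_mono fun u => ?_
        rw [← ENNReal.ofReal_add (by positivity) (by positivity),
          ← ENNReal.ofReal_mul (by positivity)]
        exact ENNReal.ofReal_le_ofReal (hpt u)
    _ ≤ _ := by
        rw [lintegral_mul_const _ (by fun_prop), lintegral_add_left (by fun_prop)]
        push_cast
        gcongr
        · exact h₁ x
        · exact h₂ x

/-- The majorant `4T / (1 + T|u|)` of the Dirichlet kernel `|∫₀ᵀ e^{iut} dt|`. -/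
noncomputable def dirichletMajorant (T u : ℝ) : ℝ≥0∞ := ENNReal.ofReal (4 * (T / (1 + T * |u|)))

lemma measurable_dirichletMajorant (T : ℝ) : Measurable (dirichletMajorant T) := by
  unfold dirichletMajorant; fun_prop

lemma dirichletMajorant_eq {T : ℝ} (hT : 0 < T) (u : ℝ) :
    dirichletMajorant T u = ENNReal.ofReal (4 * T) * ENNReal.ofReal ((1 + |T * u|) ^ (-1 : ℝ)) := by
  rw [dirichletMajorant, ← ENNReal.ofReal_mul (by positivity), abs_mul, abs_of_pos hT,
    Real.rpow_neg_one, mul_assoc, div_eq_mul_inv]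

/-- Iterated self-convolutions of `dirichletMajorant`. -/
noncomputable def dirichletConv (T : ℝ) : ℕ → ℝ → ℝ≥0∞
  | 0 => dirichletMajorant T
  | m + 1 => fun s => ∫⁻ u, dirichletMajorant T u * dirichletConv T m (s + u)

lemma measurable_dirichletConv (T : ℝ) (m : ℕ) : Measurable (dirichletConv T m) := by
  induction m with
  | zero => exact measurable_dirichletMajorant T
  | succ m ih =>
    simp only [dirichletConv]
    refine Measurable.lintegral_prod_right' (f := fun x : ℝ × ℝ =>
      dirichletMajorant T x.2 * dirichletConv T m (x.1 + x.2)) ?_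
    exact ((measurable_dirichletMajorant T).comp measurable_snd).mul
      (ih.comp (measurable_fst.add measurable_snd))

lemma exists_dirichletConv_le (m : ℕ) {b : ℝ} (hb : 0 ≤ b) (hb1 : b < 1) :
    ∃ C : ℝ≥0, ∀ T : ℝ, 0 < T → ∀ x,
      dirichletConv T m x ≤ C * (ENNReal.ofReal T * ENNReal.ofReal ((1 + |T * x|) ^ (-b))) := by
  induction m generalizing b with
  | zero =>
    refine ⟨4, fun T hT x => ?_⟩
    rw [dirichletConv, dirichletMajorant_eq hT, ENNReal.ofReal_mul (by norm_num)]
    simp only [ENNReal.ofReal_ofNat, ENNReal.coe_ofNat, mul_assoc]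
    gcongr
    exact le_add_of_nonneg_right (abs_nonneg _)
  | succ m ih =>
    -- Each convolution lowers the decay exponent slightly, so the induction hypothesis is taken
    -- midway between b and 1. The powers of T combine as T · T · T⁻¹ = T.
    obtain ⟨C, hC⟩ := ih (b := (1 + b) / 2) (by linarith) (by linarith)
    obtain ⟨C', hC'⟩ := exists_lintegral_inv_mul_rpow_le (b := (1 + b) / 2) (c := b) hb
      (by linarith) (by linarith)
    refine ⟨4 * C * C', fun T hT x => ?_⟩
    calc dirichletConv T (m + 1) x
        ≤ ∫⁻ u, (ENNReal.ofReal (4 * T) * (C * ENNReal.ofReal T)) *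
          (fun v => ENNReal.ofReal ((1 + |v|) ^ (-1 : ℝ) * (1 + |T * x + v|) ^ (-((1 + b) / 2))))
            (T * u) := by
          rw [dirichletConv]
          refine lintegral_mono fun u => ?_
          simp only
          rw [ENNReal.ofReal_mul (p := (1 + |T * u|) ^ (-1 : ℝ)) (by positivity), ← mul_add,
            dirichletMajorant_eq hT]
          calc _ ≤ ENNReal.ofReal (4 * T) * ENNReal.ofReal ((1 + |T * u|) ^ (-1 : ℝ)) *
                (C * (ENNReal.ofReal T *
                  ENNReal.ofReal ((1 + |T * (x + u)|) ^ (-((1 + b) / 2))))) := by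
                gcongr
                exact hC T hT _
            _ = _ := by ring
      _ = (ENNReal.ofReal (4 * T) * (C * ENNReal.ofReal T)) * (ENNReal.ofReal T⁻¹ *
          ∫⁻ v, ENNReal.ofReal ((1 + |v|) ^ (-1 : ℝ) * (1 + |T * x + v|) ^ (-((1 + b) / 2)))) := by
          rw [lintegral_const_mul _ (by fun_prop), lintegral_comp_mul_left_real
            (F := fun v => ENNReal.ofReal ((1 + |v|) ^ (-1 : ℝ) *
              (1 + |T * x + v|) ^ (-((1 + b) / 2)))) (by fun_prop) hT]
      _ ≤ (ENNReal.ofReal (4 * T) * (C * ENNReal.ofReal T)) * (ENNReal.ofReal T⁻¹ *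
          (C' * ENNReal.ofReal ((1 + |T * x|) ^ (-b)))) := by
          gcongr
          exact hC' _
      _ = (ENNReal.ofReal T * ENNReal.ofReal T⁻¹) * ((4 * C * C') *
            (ENNReal.ofReal T * ENNReal.ofReal ((1 + |T * x|) ^ (-b)))) := by
          rw [ENNReal.ofReal_mul (by norm_num)]
          simp only [ENNReal.ofReal_ofNat]
          ring
      _ = _ := by
          rw [← ENNReal.ofReal_mul hT.le, mul_inv_cancel₀ hT.ne']
          simp

/-- The closing estimate: `∫ k_T(u) |u|^γ k_T^{*m}(u) du = O(T^{1-γ})`. -/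
lemma exists_lintegral_dirichlet_rpow_le (m : ℕ) {γ : ℝ} (hγ : 0 ≤ γ) (hγ1 : γ < 1) :
    ∃ C : ℝ≥0, ∀ T : ℝ, 0 < T →
      ∫⁻ u, dirichletMajorant T u * (ENNReal.ofReal (|u| ^ γ) * dirichletConv T m u) ≤
        C * ENNReal.ofReal (T ^ (1 - γ)) := by
  -- Any b strictly between γ and 1 would serve: after v = Tu the integrand decays like
  -- (1+|v|)^{-1+γ-b}. For the midpoint the exponent is -(1 + (1-γ)/2).
  obtain ⟨C, hC⟩ := exists_dirichletConv_le m (b := (1 + γ) / 2) (by linarith) (by linarith)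
  set I := ∫⁻ u : ℝ, ENNReal.ofReal ((1 + |u|) ^ (-(1 + (1 - γ) / 2))) with hI
  have hfin : I < ∞ := lintegral_one_add_abs_lt_top (by linarith)
  refine ⟨4 * C * I.toNNReal, fun T hT => ?_⟩
  have hpt : ∀ u, dirichletMajorant T u * (ENNReal.ofReal (|u| ^ γ) * dirichletConv T m u) ≤
      (4 * C * ENNReal.ofReal (T ^ (2 - γ))) *
        (fun v => ENNReal.ofReal ((1 + |v|) ^ (-(1 + (1 - γ) / 2)))) (T * u) := by
    intro u
    have h1 : |u| ^ γ ≤ T ^ (-γ) * (1 + |T * u|) ^ γ := by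
      have e : |u| = T⁻¹ * |T * u| := by
        rw [abs_mul, abs_of_pos hT, ← mul_assoc, inv_mul_cancel₀ hT.ne', one_mul]
      calc |u| ^ γ = T ^ (-γ) * |T * u| ^ γ := by
            rw [e, Real.mul_rpow (by positivity) (abs_nonneg _), Real.inv_rpow hT.le,
              Real.rpow_neg hT.le]
        _ ≤ _ := by
          gcongr
          linarith
    have hA : 0 < 1 + |T * u| := by positivity
    calc _ ≤ (ENNReal.ofReal (4 * T) * ENNReal.ofReal ((1 + |T * u|) ^ (-1 : ℝ))) *
          (ENNReal.ofReal (T ^ (-γ) * (1 + |T * u|) ^ γ) *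
          (C * (ENNReal.ofReal T * ENNReal.ofReal ((1 + |T * u|) ^ (-((1 + γ) / 2)))))) := by
          rw [dirichletMajorant_eq hT]
          gcongr
          exact hC T hT u
      _ = 4 * C * (ENNReal.ofReal (T * T ^ (-γ) * T) * ENNReal.ofReal ((1 + |T * u|) ^ (-1 : ℝ) *
          (1 + |T * u|) ^ γ * (1 + |T * u|) ^ (-((1 + γ) / 2)))) := by
          rw [ENNReal.ofReal_mul (by positivity), ENNReal.ofReal_mul (by positivity),
            ENNReal.ofReal_mul (by positivity), ENNReal.ofReal_mul (by positivity),
            ENNReal.ofReal_mul (by positivity), ENNReal.ofReal_mul (by positivity)]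
          simp only [ENNReal.ofReal_ofNat]
          ring
      _ = _ := by
          rw [← Real.rpow_add hA, ← Real.rpow_add hA, mul_assoc (4 * (C : ℝ≥0∞))]
          congr 3
          · have e : T * T ^ (-γ) * T = T ^ (1 : ℝ) * T ^ (-γ) * T ^ (1 : ℝ) := by simp
            rw [e, ← Real.rpow_add hT, ← Real.rpow_add hT]
            congr 1; ring
          · congr 1; ring
  refine (lintegral_mono hpt).trans ?_
  rw [lintegral_const_mul _ (by fun_prop),
    lintegral_comp_mul_left_real (measurable_one_add_abs _) hT, ← hI]
  push_cast
  rw [ENNReal.coe_toNNReal hfin.ne]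
  have e : ENNReal.ofReal (T ^ (2 - γ)) * ENNReal.ofReal T⁻¹ = ENNReal.ofReal (T ^ (1 - γ)) := by
    rw [← ENNReal.ofReal_mul (by positivity), ← Real.rpow_neg_one, ← Real.rpow_add hT]
    congr 2; ring
  rw [← e]
  apply le_of_eq
  ring

/-! ### Hölder bounds for cyclic products -/

/-- The kernel of the product of Toeplitz operators with symbols in `L`, with every factor replaced
by its majorant. The second components (integrability exponents) play no role here. -/
noncomputable def majorantKernel (T : ℝ) : List ((ℝ → ℝ) × ℝ≥0∞) → ℝ → ℝ → ℝ≥0∞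
  | [], x, y => dirichletMajorant T (x - y)
  | a :: L, x, y => ∫⁻ l, dirichletMajorant T (l - x) * (‖a.1 l‖ₑ * majorantKernel T L l y)

lemma measurable_majorantKernel (T : ℝ) {L : List ((ℝ → ℝ) × ℝ≥0∞)}
    (hL : ∀ a ∈ L, Measurable a.1) :
    Measurable fun x : ℝ × ℝ => majorantKernel T L x.1 x.2 := by
  induction L with
  | nil => exact (measurable_dirichletMajorant T).comp (measurable_fst.sub measurable_snd)
  | cons a L ih =>
    have ih := ih fun b hb => hL b (List.mem_cons_of_mem _ hb)
    have ha := hL a List.mem_cons_self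
    simp only [majorantKernel]
    refine Measurable.lintegral_prod_right' (f := fun z : (ℝ × ℝ) × ℝ =>
      dirichletMajorant T (z.2 - z.1.1) * (‖a.1 z.2‖ₑ * majorantKernel T L z.2 z.1.2)) ?_
    refine ((measurable_dirichletMajorant T).comp
      (measurable_snd.sub (measurable_fst.comp measurable_fst))).mul
      ((ha.comp measurable_snd).enorm.mul ?_)
    have hp : Measurable fun z : (ℝ × ℝ) × ℝ => (z.2, z.1.2) :=
      measurable_snd.prodMk (measurable_snd.comp measurable_fst)
    exact ih.comp hp

lemma eLpNorm_mul_le_mul_eLpNorm {p q r : ℝ≥0∞} (hpqr : p⁻¹ + q⁻¹ = r⁻¹) {F G : ℝ → ℝ}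
    (hF : Measurable F) (hG : Measurable G) :
    eLpNorm (fun x => F x * G x) r volume ≤ eLpNorm F p volume * eLpNorm G q volume := by
  have : ENNReal.HolderTriple p q r := ⟨hpqr⟩
  have h := eLpNorm_smul_le_mul_eLpNorm (μ := volume) (f := G) (φ := F) (p := p) (q := q) (r := r)
    hG.aestronglyMeasurable hF.aestronglyMeasurable
  rw [smul_eq_mul] at h
  exact h

lemma eLpNorm_comp_add_right (p : ℝ≥0∞) {F : ℝ → ℝ} (hF : Measurable F) (s : ℝ) :
    eLpNorm (fun x => F (x + s)) p volume = eLpNorm F p volume :=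
  eLpNorm_comp_measurePreserving hF.aestronglyMeasurable (measurePreserving_add_right volume s)

/-- A Young–Hölder inequality for cyclic products. -/
lemma lintegral_mul_majorantKernel_le (T : ℝ) (L : List ((ℝ → ℝ) × ℝ≥0∞))
    (hL : ∀ a ∈ L, Measurable a.1) (G : ℝ → ℝ) (r : ℝ≥0∞) (hG : Measurable G)
    (hr : r⁻¹ + (L.map fun a => a.2⁻¹).sum = 1) (s : ℝ) :
    ∫⁻ x, ‖G x‖ₑ * majorantKernel T L (x + s) x ≤
      eLpNorm G r volume * (L.map fun a => eLpNorm a.1 a.2 volume).prod *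
        dirichletConv T L.length s := by
  induction L generalizing G r s with
  | nil =>
    have hr1 : r = 1 := by simpa using hr
    simp only [majorantKernel, add_sub_cancel_left, List.map_nil, List.prod_nil, mul_one,
      List.length_nil, dirichletConv]
    rw [lintegral_mul_const _ hG.enorm, hr1, eLpNorm_one_eq_lintegral_enorm]
  | cons a L ih =>
    have hL' : ∀ b ∈ L, Measurable b.1 := fun b hb => hL b (List.mem_cons_of_mem _ hb)
    have ha := hL a List.mem_cons_self
    have hm := measurable_majorantKernel T hL'
    -- With l = x + s + u and u held fixed, the first symbol is a translate in x. Hölder merges it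
    -- with G into a single L^{r'} function, and the induction continues with shift s + u.
    set r' := (r⁻¹ + a.2⁻¹)⁻¹ with hr'
    have hr'' : r'⁻¹ + (L.map fun a => a.2⁻¹).sum = 1 := by
      rw [hr', inv_inv, ← hr, List.map_cons, List.sum_cons, add_assoc]
    calc _ = ∫⁻ x, ∫⁻ u, dirichletMajorant T u *
          (‖G x * a.1 (x + (s + u))‖ₑ * majorantKernel T L (x + (s + u)) x) := by
          refine lintegral_congr fun x => ?_
          rw [majorantKernel, ← lintegral_const_mul']
          · rw [← lintegral_add_left_eq_self _ (x + s)]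
            refine lintegral_congr fun u => ?_
            rw [enorm_mul, add_sub_cancel_left, add_assoc]
            ring
          · exact enorm_ne_top
      _ = ∫⁻ u, ∫⁻ x, dirichletMajorant T u *
          (‖G x * a.1 (x + (s + u))‖ₑ * majorantKernel T L (x + (s + u)) x) := by
          refine lintegral_lintegral_swap (Measurable.aemeasurable ?_)
          refine ((measurable_dirichletMajorant T).comp measurable_snd).mul
            (Measurable.mul ?_ ?_)
          · exact ((hG.comp measurable_fst).mul (ha.comp (by fun_prop))).enorm
          · exact hm.comp (f := fun z : ℝ × ℝ => (z.1 + (s + z.2), z.1)) (by fun_prop)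
      _ ≤ ∫⁻ u, (eLpNorm G r volume * eLpNorm a.1 a.2 volume *
            (L.map fun a => eLpNorm a.1 a.2 volume).prod) *
            (dirichletMajorant T u * dirichletConv T L.length (s + u)) := by
          refine lintegral_mono fun u => ?_
          have hGa : Measurable fun x => G x * a.1 (x + (s + u)) :=
            hG.mul (ha.comp (measurable_add_const _))
          simp only
          rw [lintegral_const_mul]
          · calc _ ≤ dirichletMajorant T u * (eLpNorm (fun x => G x * a.1 (x + (s + u))) r' volume *
                  (L.map fun a => eLpNorm a.1 a.2 volume).prod *
                    dirichletConv T L.length (s + u)) := by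
                  gcongr
                  exact ih hL' _ r' hGa hr'' (s + u)
              _ ≤ dirichletMajorant T u * (eLpNorm G r volume * eLpNorm a.1 a.2 volume *
                  (L.map fun a => eLpNorm a.1 a.2 volume).prod *
                    dirichletConv T L.length (s + u)) := by
                  gcongr
                  refine (eLpNorm_mul_le_mul_eLpNorm (p := r) (q := a.2) (by rw [hr', inv_inv]) hG
                    (ha.comp (measurable_add_const (s + u)))).trans (le_of_eq ?_)
                  congr 1
                  exact eLpNorm_comp_add_right _ ha _
              _ = _ := by ring
          · exact hGa.enorm.mul
              (hm.comp (f := fun x : ℝ => (x + (s + u), x)) (by fun_prop))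
      _ = _ := by
          rw [lintegral_const_mul, List.map_cons, List.prod_cons, List.length_cons]
          · simp only [dirichletConv]
            ring
          · exact (measurable_dirichletMajorant T).mul
              ((measurable_dirichletConv T _).comp (measurable_const_add s))

/-! ### Replacing operators by scalars -/

/-- The product of the Toeplitz operators with symbols in `L`. -/
noncomputable def toeplitzListProd (T : ℝ) (L : List ((ℝ → ℝ) × ℝ≥0∞)) : L2T T →L[ℂ] L2T T :=
  (L.map fun a => toeplitzOp T a.1).prod

lemma enorm_inner_expVec_le {T : ℝ} (hT : 0 < T) (l m : ℝ) :
    ‖inner ℂ (expVec T l) (expVec T m)‖ₑ ≤ dirichletMajorant T (m - l) := by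
  rw [dirichletMajorant, ← ofReal_norm, abs_sub_comm]
  exact ENNReal.ofReal_le_ofReal (norm_inner_expVec_le hT l m)

lemma enorm_inner_toeplitzListProd_le {T : ℝ} (hT : 0 < T) {L : List ((ℝ → ℝ) × ℝ≥0∞)}
    (hL : ∀ a ∈ L, Integrable a.1) (x y : ℝ) :
    ‖inner ℂ (expVec T x) (toeplitzListProd T L (expVec T y))‖ₑ ≤ majorantKernel T L x y := by
  induction L generalizing x with
  | nil =>
    have h := enorm_inner_expVec_le hT y x
    rw [← ofReal_norm, norm_inner_symm, ofReal_norm] at h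
    simpa [toeplitzListProd, majorantKernel] using h
  | cons a L ih =>
    have e : toeplitzListProd T (a :: L) (expVec T y) =
        toeplitzOp T a.1 (toeplitzListProd T L (expVec T y)) := by
      simp [toeplitzListProd]
    rw [e, inner_toeplitzOp hT.le (hL a List.mem_cons_self), majorantKernel]
    refine (enorm_integral_le_lintegral_enorm _).trans (lintegral_mono fun l => ?_)
    rw [enorm_mul, enorm_mul]
    calc _ ≤ ‖((a.1 l : ℝ) : ℂ)‖ₑ * (dirichletMajorant T (l - x) * majorantKernel T L l y) := by
          gcongr
          · exact enorm_inner_expVec_le hT x l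
          · exact ih (fun b hb => hL b (List.mem_cons_of_mem _ hb)) l
      _ = _ := by
          rw [← ofReal_norm ((a.1 l : ℝ) : ℂ), Complex.norm_real, ofReal_norm]
          ring

lemma integrable_mul_inner_inner {T : ℝ} (hT : 0 ≤ T) {h : ℝ → ℝ} (hh : Integrable h)
    (u v : L2T T) :
    Integrable fun l => (h l : ℂ) * (inner ℂ u (expVec T l) * inner ℂ (expVec T l) v) := by
  refine hh.ofReal.mul_bdd (c := (‖u‖ * √T) * (√T * ‖v‖)) ?_ (Eventually.of_forall fun l => ?_)
  · exact ((continuous_const.inner (continuous_expVec hT)).mul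
      ((continuous_expVec hT).inner continuous_const)).aestronglyMeasurable
  · rw [norm_mul]
    have h1 := norm_inner_le_norm (𝕜 := ℂ) u (expVec T l)
    have h2 := norm_inner_le_norm (𝕜 := ℂ) (expVec T l) v
    rw [norm_expVec hT] at h1 h2
    gcongr

/-- Parseval writes 2π h(x) ⟨e_x, v⟩ as the integral for W_T(h) with h(l) frozen at h(x). The
difference therefore involves only h(l) - h(x). -/
lemma enorm_inner_toeplitzOp_sub_le {T : ℝ} (hT : 0 < T) {h : ℝ → ℝ} (hh : Integrable h)
    {L : List ((ℝ → ℝ) × ℝ≥0∞)} (hL : ∀ a ∈ L, Integrable a.1) (x : ℝ) :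
    ‖inner ℂ (expVec T x) (toeplitzOp T h (toeplitzListProd T L (expVec T x))) -
      2 * Real.pi * h x * inner ℂ (expVec T x) (toeplitzListProd T L (expVec T x))‖ₑ ≤
      ∫⁻ u, dirichletMajorant T u * (‖h (x + u) - h x‖ₑ * majorantKernel T L (x + u) x) := by
  set v := toeplitzListProd T L (expVec T x) with hv
  have e : inner ℂ (expVec T x) (toeplitzOp T h v) -
      2 * Real.pi * h x * inner ℂ (expVec T x) v =
      ∫ l, ((h l - h x : ℝ) : ℂ) * (inner ℂ (expVec T x) (expVec T l) * inner ℂ (expVec T l) v) := by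
    have h1 : (2 * Real.pi * h x * inner ℂ (expVec T x) v : ℂ) =
        ∫ l, (h x : ℂ) * (inner ℂ (expVec T x) (expVec T l) * inner ℂ (expVec T l) v) := by
      rw [integral_const_mul, integral_inner_mul_inner]
      ring
    rw [h1, inner_toeplitzOp hT.le hh, ← integral_sub (integrable_mul_inner_inner hT.le hh _ _)
      ((integrable_inner_mul_inner _ _).const_mul _)]
    congr 1
    ext l
    push_cast
    ring
  rw [e]
  refine (enorm_integral_le_lintegral_enorm _).trans ?_
  rw [← lintegral_add_left_eq_self _ x]
  refine lintegral_mono fun u => ?_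
  simp only
  rw [enorm_mul, enorm_mul, ← ofReal_norm ((h (x + u) - h x : ℝ) : ℂ), Complex.norm_real,
    ofReal_norm]
  have h1 := enorm_inner_expVec_le hT x (x + u)
  rw [add_sub_cancel_left] at h1
  calc _ ≤ ‖h (x + u) - h x‖ₑ * (dirichletMajorant T u * majorantKernel T L (x + u) x) := by
        gcongr
        exact enorm_inner_toeplitzListProd_le hT hL _ _
    _ = _ := by ring

/-- For fixed u, the product of H and the increment of h plays the role of G in the cyclic Hölder
bound with shift u. Its norm supplies |u|^γ, and the remaining u-integral is the closing Dirichlet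
estimate. -/
lemma exists_lintegral_increment_le {γ : ℝ} (hγ : 0 ≤ γ) (hγ1 : γ < 1) {H h : ℝ → ℝ}
    {r p : ℝ≥0∞} {L : List ((ℝ → ℝ) × ℝ≥0∞)} (hL : ∀ a ∈ L, Measurable a.1)
    (hL2 : ∀ a ∈ L, eLpNorm a.1 a.2 volume ≠ ∞) (hH : Measurable H) (hh : Measurable h)
    (hH2 : eLpNorm H r volume ≠ ∞)
    {C₀ : ℝ≥0} (hlip : ∀ u : ℝ, eLpNorm (fun x => h (x + u) - h x) p volume ≤
      C₀ * ENNReal.ofReal (|u| ^ γ))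
    (hr : r⁻¹ + (p⁻¹ + (L.map fun a => a.2⁻¹).sum) = 1) :
    ∃ C : ℝ≥0, ∀ T : ℝ, 0 < T → ∫⁻ x, ‖H x‖ₑ * ∫⁻ u, dirichletMajorant T u *
      (‖h (x + u) - h x‖ₑ * majorantKernel T L (x + u) x) ≤ C * ENNReal.ofReal (T ^ (1 - γ)) := by
  obtain ⟨C, hC⟩ := exists_lintegral_dirichlet_rpow_le L.length hγ hγ1
  set P := (L.map fun a => eLpNorm a.1 a.2 volume).prod with hP
  have hPtop : P ≠ ∞ := by
    have : ∀ M : List ℝ≥0∞, (∀ a ∈ M, a ≠ ∞) → M.prod ≠ ∞ := by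
      intro M
      induction M with
      | nil => simp
      | cons a M ih =>
        intro hM
        rw [List.prod_cons]
        exact ENNReal.mul_ne_top (hM a List.mem_cons_self)
          (ih fun b hb => hM b (List.mem_cons_of_mem _ hb))
    refine this _ fun a ha => ?_
    obtain ⟨b, hb, rfl⟩ := List.mem_map.1 ha
    exact hL2 b hb
  refine ⟨(eLpNorm H r volume).toNNReal * C₀ * P.toNNReal * C, fun T hT => ?_⟩
  push_cast
  rw [ENNReal.coe_toNNReal hH2, ENNReal.coe_toNNReal hPtop]
  have hm := measurable_majorantKernel T hL
  set r' := (r⁻¹ + p⁻¹)⁻¹ with hr'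
  have hr'' : r'⁻¹ + (L.map fun a => a.2⁻¹).sum = 1 := by
    rw [hr', inv_inv, ← hr, add_assoc]
  have hd : ∀ u, Measurable fun x => h (x + u) - h x := fun u =>
    (hh.comp (measurable_add_const u)).sub hh
  calc _ = ∫⁻ x, ∫⁻ u, dirichletMajorant T u *
        (‖H x * (h (x + u) - h x)‖ₑ * majorantKernel T L (x + u) x) := by
        refine lintegral_congr fun x => ?_
        rw [← lintegral_const_mul' _ _ enorm_ne_top]
        refine lintegral_congr fun u => ?_
        rw [enorm_mul]
        ring
    _ = ∫⁻ u, ∫⁻ x, dirichletMajorant T u *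
        (‖H x * (h (x + u) - h x)‖ₑ * majorantKernel T L (x + u) x) := by
        refine lintegral_lintegral_swap (Measurable.aemeasurable ?_)
        refine ((measurable_dirichletMajorant T).comp measurable_snd).mul (Measurable.mul ?_ ?_)
        · exact ((hH.comp measurable_fst).mul
            ((hh.comp (by fun_prop)).sub (hh.comp measurable_fst))).enorm
        · exact hm.comp (f := fun z : ℝ × ℝ => (z.1 + z.2, z.1)) (by fun_prop)
    _ ≤ ∫⁻ u, (eLpNorm H r volume * C₀ * P) *
        (dirichletMajorant T u * (ENNReal.ofReal (|u| ^ γ) * dirichletConv T L.length u)) := by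
        refine lintegral_mono fun u => ?_
        simp only
        rw [lintegral_const_mul]
        · calc _ ≤ dirichletMajorant T u * (eLpNorm (fun x => H x * (h (x + u) - h x)) r' volume *
                P * dirichletConv T L.length u) := by
                gcongr
                exact lintegral_mul_majorantKernel_le T L hL _ r' (hH.mul (hd u)) hr'' u
            _ ≤ dirichletMajorant T u * (eLpNorm H r volume *
                (C₀ * ENNReal.ofReal (|u| ^ γ)) * P * dirichletConv T L.length u) := by
                gcongr
                refine (eLpNorm_mul_le_mul_eLpNorm (p := r) (q := p) (by rw [hr', inv_inv]) hH
                  (hd u)).trans ?_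
                gcongr
                exact hlip u
            _ = _ := by ring
        · exact (hH.mul (hd u)).enorm.mul
            (hm.comp (f := fun x : ℝ => (x + u, x)) (by fun_prop))
    _ ≤ _ := by
        rw [lintegral_const_mul, mul_assoc _ (C : ℝ≥0∞)]
        · gcongr
          exact hC T hT
        · exact (measurable_dirichletMajorant T).mul
            (Measurable.mul (by fun_prop) (measurable_dirichletConv T _))

/-- The symbol of a factor: an integrable function of class `Lip(ℝ; p, γ)`, where the modulus of
continuity is controlled for all increments. -/
structure LipSymbol (γ : ℝ) (h : ℝ → ℝ) (p : ℝ≥0∞) : Prop where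
  measurable : Measurable h
  integrable : Integrable h
  eLpNorm_ne_top : eLpNorm h p volume ≠ ∞
  increment : ∃ C : ℝ≥0, ∀ u : ℝ, eLpNorm (fun x => h (x + u) - h x) p volume ≤
    C * ENNReal.ofReal (|u| ^ γ)

/-- The telescoping. H accumulates the scalars 2π a(x) of the operators already replaced, and r is
its current Hölder exponent; hence both vary in the induction. With no operators left the error is
zero, as ⟨e_x, e_x⟩ = T. -/
lemma exists_lintegral_trace_sub_le {γ : ℝ} (hγ : 0 ≤ γ) (hγ1 : γ < 1)
    (L : List ((ℝ → ℝ) × ℝ≥0∞)) (hL : ∀ a ∈ L, LipSymbol γ a.1 a.2) (H : ℝ → ℝ) (r : ℝ≥0∞)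
    (hH : Measurable H) (hH2 : eLpNorm H r volume ≠ ∞)
    (hr : r⁻¹ + (L.map fun a => a.2⁻¹).sum = 1) :
    ∃ C : ℝ≥0, ∀ T : ℝ, 0 < T →
      ∫⁻ x, ‖(H x : ℂ) * inner ℂ (expVec T x) (toeplitzListProd T L (expVec T x)) -
        (((2 * Real.pi) ^ L.length * T * (H x * (L.map fun a => a.1 x).prod) : ℝ) : ℂ)‖ₑ ≤
      C * ENNReal.ofReal (T ^ (1 - γ)) := by
  induction L generalizing H r with
  | nil =>
    refine ⟨0, fun T hT => ?_⟩
    have : ∀ x, ‖(H x : ℂ) * inner ℂ (expVec T x) (toeplitzListProd T [] (expVec T x)) -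
        (((2 * Real.pi) ^ ([] : List ((ℝ → ℝ) × ℝ≥0∞)).length * T *
          (H x * (([] : List ((ℝ → ℝ) × ℝ≥0∞)).map fun a => a.1 x).prod) : ℝ) : ℂ)‖ₑ = 0 := by
      intro x
      rw [enorm_eq_zero, sub_eq_zero, toeplitzListProd, List.map_nil, List.prod_nil,
        one_apply_eq_self, inner_expVec_self hT.le]
      simp [mul_comm]
    simp only [this]
    simp
  | cons a L ih =>
    have hL' : ∀ b ∈ L, LipSymbol γ b.1 b.2 := fun b hb => hL b (List.mem_cons_of_mem _ hb)
    have ha := hL a List.mem_cons_self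
    obtain ⟨C₀, hC₀⟩ := ha.increment
    have hLm : ∀ b ∈ L, Measurable b.1 := fun b hb => (hL' b hb).measurable
    rw [List.map_cons, List.sum_cons] at hr
    obtain ⟨C₁, hC₁⟩ := exists_lintegral_increment_le hγ hγ1 hLm
      (fun b hb => (hL' b hb).eLpNorm_ne_top) hH ha.measurable hH2 hC₀ hr
    have hH'm : Measurable fun x => 2 * Real.pi * (H x * a.1 x) :=
      (hH.mul ha.measurable).const_mul _
    have hH'n : eLpNorm (fun x => 2 * Real.pi * (H x * a.1 x)) (r⁻¹ + a.2⁻¹)⁻¹ volume ≠ ∞ := by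
      have e : (fun x => 2 * Real.pi * (H x * a.1 x)) =
          (2 * Real.pi) • fun x => H x * a.1 x := rfl
      rw [e, eLpNorm_const_smul]
      refine ENNReal.mul_ne_top enorm_ne_top (ne_top_of_le_ne_top
        (ENNReal.mul_ne_top hH2 ha.eLpNorm_ne_top) (eLpNorm_mul_le_mul_eLpNorm (by rw [inv_inv])
          hH ha.measurable))
    obtain ⟨C₂, hC₂⟩ := ih hL' _ _ hH'm hH'n (by rw [inv_inv, add_assoc, hr])
    refine ⟨C₁ + C₂, fun T hT => ?_⟩
    have hLi : ∀ b ∈ L, Integrable b.1 := fun b hb => (hL' b hb).integrable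
    have hmA : Measurable fun x => ‖H x‖ₑ * ∫⁻ u, dirichletMajorant T u *
        (‖a.1 (x + u) - a.1 x‖ₑ * majorantKernel T L (x + u) x) := by
      refine hH.enorm.mul (Measurable.lintegral_prod_right' (f := fun z : ℝ × ℝ =>
        dirichletMajorant T z.2 *
          (‖a.1 (z.1 + z.2) - a.1 z.1‖ₑ * majorantKernel T L (z.1 + z.2) z.1)) ?_)
      refine ((measurable_dirichletMajorant T).comp measurable_snd).mul (Measurable.mul ?_ ?_)
      · exact ((ha.measurable.comp (by fun_prop)).sub (ha.measurable.comp measurable_fst)).enorm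
      · exact (measurable_majorantKernel T hLm).comp
          (f := fun z : ℝ × ℝ => (z.1 + z.2, z.1)) (by fun_prop)
    push_cast
    rw [add_mul]
    refine le_trans ?_ (add_le_add (hC₁ T hT) (hC₂ T hT))
    rw [← lintegral_add_left hmA]
    refine lintegral_mono fun x => ?_
    have e : (H x : ℂ) * inner ℂ (expVec T x) (toeplitzListProd T (a :: L) (expVec T x)) -
        (((2 * Real.pi) ^ (a :: L).length * T *
          (H x * ((a :: L).map fun a => a.1 x).prod) : ℝ) : ℂ) =
        (H x : ℂ) * (inner ℂ (expVec T x) (toeplitzOp T a.1 (toeplitzListProd T L (expVec T x))) -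
          2 * Real.pi * a.1 x * inner ℂ (expVec T x) (toeplitzListProd T L (expVec T x))) +
        (((2 * Real.pi * (H x * a.1 x) : ℝ) : ℂ) *
          inner ℂ (expVec T x) (toeplitzListProd T L (expVec T x)) -
          (((2 * Real.pi) ^ L.length * T *
            (2 * Real.pi * (H x * a.1 x) * (L.map fun a => a.1 x).prod) : ℝ) : ℂ)) := by
      have e1 : toeplitzListProd T (a :: L) (expVec T x) =
          toeplitzOp T a.1 (toeplitzListProd T L (expVec T x)) := by simp [toeplitzListProd]
      rw [e1, List.length_cons, List.map_cons, List.prod_cons]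
      push_cast
      ring
    push_cast at e ⊢
    rw [e]
    refine (enorm_add_le _ _).trans (add_le_add ?_ le_rfl)
    rw [enorm_mul, ← ofReal_norm (H x : ℂ), Complex.norm_real, ofReal_norm]
    gcongr
    exact enorm_inner_toeplitzOp_sub_le hT ha.integrable hLi x

/-! ### Integrability and increments of the Riesz–Bessel density -/

lemma integrableOn_abs_rpow_Icc {r : ℝ} (hr : -1 < r) :
    IntegrableOn (fun x : ℝ => |x| ^ r) (Set.Icc (-1) 1) := by
  have h1 : IntervalIntegrable (fun x : ℝ => |x| ^ r) volume 0 1 := by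
    refine (intervalIntegral.intervalIntegrable_rpow' hr (a := 0) (b := 1)).congr ?_
    rw [Set.uIoc_of_le zero_le_one]
    intro x hx
    simp only [abs_of_pos hx.1]
  have h2 : IntervalIntegrable (fun x : ℝ => |x| ^ r) volume (-1) 0 := by
    have h := ((IntervalIntegrable.iff_comp_neg (by simp)).1 h1).symm
    simpa using h
  rw [integrableOn_Icc_iff_integrableOn_Ioc, ← intervalIntegrable_iff_integrableOn_Ioc_of_le
    (by norm_num)]
  exact h2.trans h1

lemma integrable_abs_rpow_mul {s t : ℝ} (hs : s < 1) (ht : 0 ≤ t)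
    (hst : 1 < s + 2 * t) :
    Integrable fun x : ℝ => |x| ^ (-s) * (1 + x ^ 2) ^ (-t) := by
  have h1 : Integrable ((Set.Icc (-1 : ℝ) 1).indicator fun x : ℝ => |x| ^ (-s)) :=
    (integrable_indicator_iff measurableSet_Icc).2 (integrableOn_abs_rpow_Icc (by linarith))
  have h2 : Integrable fun x : ℝ => 2 ^ (s + 2 * t) * (1 + |x|) ^ (-(s + 2 * t)) := by
    have := integrable_one_add_norm (E := ℝ) (μ := volume) (r := s + 2 * t) (by simpa using hst)
    simp only [Real.norm_eq_abs] at this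
    exact this.const_mul _
  refine (h1.add h2).mono' (Measurable.aestronglyMeasurable (by fun_prop))
    (Eventually.of_forall fun x => ?_)
  rw [Real.norm_of_nonneg (by positivity), Pi.add_apply]
  by_cases hx : x ∈ Set.Icc (-1 : ℝ) 1
  · rw [Set.indicator_of_mem hx]
    refine le_add_of_le_of_nonneg ?_ (by positivity)
    refine mul_le_of_le_one_right (by positivity) ?_
    exact Real.rpow_le_one_of_one_le_of_nonpos (by nlinarith [sq_nonneg x]) (neg_nonpos.2 ht)
  · rw [Set.indicator_of_notMem hx, zero_add]
    have hx1 : 1 < |x| := by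
      by_contra h
      exact hx (abs_le.1 (not_lt.1 h))
    have hx0 : 0 < |x| := by linarith
    calc |x| ^ (-s) * (1 + x ^ 2) ^ (-t) ≤ |x| ^ (-s) * (|x| ^ (2 : ℝ)) ^ (-t) := by
          refine mul_le_mul_of_nonneg_left ?_ (by positivity)
          refine Real.rpow_le_rpow_of_nonpos (by positivity) ?_ (by linarith)
          rw [Real.rpow_two, sq_abs]
          linarith
      _ = |x| ^ (-(s + 2 * t)) := by
          rw [← Real.rpow_mul hx0.le, ← Real.rpow_add hx0]
          congr 1; ring
      _ ≤ ((1 + |x|) / 2) ^ (-(s + 2 * t)) :=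
          Real.rpow_le_rpow_of_nonpos (by positivity) (by linarith) (by linarith)
      _ = _ := by
          rw [Real.div_rpow (by positivity) (by norm_num), Real.rpow_neg (x := 2) (by norm_num),
            div_inv_eq_mul, mul_comm]

lemma measurable_rieszBessel (c α β : ℝ) : Measurable (rieszBessel c α β) := by
  unfold rieszBessel
  fun_prop

lemma memLp_rieszBessel {c α β ρ : ℝ} (hc : 0 ≤ c) (hβ : 0 ≤ β) (hρ : 1 ≤ ρ)
    (hαρ : 2 * α * ρ < 1) (hαβ : 1 < 2 * (α + β) * ρ) :
    MemLp (rieszBessel c α β) (ENNReal.ofReal ρ) volume := by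
  have hρ0 : 0 < ρ := by linarith
  rw [← integrable_norm_rpow_iff (measurable_rieszBessel c α β).aestronglyMeasurable
    (by simpa using hρ0) ENNReal.ofReal_ne_top, ENNReal.toReal_ofReal hρ0.le]
  refine ((integrable_abs_rpow_mul (s := 2 * α * ρ) (t := β * ρ) hαρ (by positivity)
    (by linarith)).const_mul (c ^ ρ)).congr (Eventually.of_forall fun x => ?_)
  simp only [rieszBessel]
  rw [Real.norm_of_nonneg (by positivity), Real.mul_rpow (by positivity) (by positivity),
    Real.mul_rpow hc (by positivity), ← Real.rpow_mul (abs_nonneg _),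
    ← Real.rpow_mul (by positivity)]
  ring_nf

lemma rieszBessel_abs (c α β x : ℝ) : rieszBessel c α β |x| = rieszBessel c α β x := by
  simp [rieszBessel]

lemma one_sub_rpow_le {t s : ℝ} (ht : 0 < t) (ht1 : t ≤ 1) : 1 - t ^ s ≤ max 1 s * (1 - t) := by
  rcases le_total 1 s with h | h
  · rw [max_eq_right h]
    have := one_add_mul_self_le_rpow_one_add (s := t - 1) (by linarith) h
    rw [add_sub_cancel] at this
    linarith
  · rw [max_eq_left h]
    have := Real.rpow_le_rpow_of_exponent_ge ht ht1 h
    rw [Real.rpow_one] at this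
    linarith

/-- Multiplying the density by λ^{2(α+β)} gives c (λ²/(1+λ²))^β, which is nondecreasing on λ > 0.
This bounds increments without differentiating. -/
lemma rieszBessel_mul_rpow_le {c α β a b : ℝ} (hc : 0 ≤ c) (hβ : 0 ≤ β) (ha : 0 < a) (hab : a ≤ b) :
    rieszBessel c α β a * (a / b) ^ (2 * (α + β)) ≤ rieszBessel c α β b := by
  have hb : 0 < b := ha.trans_le hab
  have ht : 0 < a / b := by positivity
  have e1 : |b| ^ (-2 * α) = |a| ^ (-2 * α) * (a / b) ^ (2 * α) := by
    rw [abs_of_pos ha, abs_of_pos hb, Real.div_rpow ha.le hb.le, neg_mul, Real.rpow_neg ha.le,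
      Real.rpow_neg hb.le]
    have := Real.rpow_pos_of_pos ha (2 * α)
    field_simp
  have e2 : (1 + a ^ 2) ^ (-β) * (a / b) ^ (2 * β) ≤ (1 + b ^ 2) ^ (-β) := by
    have : (1 + a ^ 2) ^ (-β) * (a / b) ^ (2 * β) = ((1 + a ^ 2) / (a / b) ^ 2) ^ (-β) := by
      rw [Real.div_rpow (x := 1 + a ^ 2) (by positivity) (by positivity),
        Real.rpow_neg (x := (a / b) ^ 2) (by positivity), div_inv_eq_mul,
        ← Real.rpow_two (a / b), ← Real.rpow_mul ht.le]
    rw [this]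
    refine Real.rpow_le_rpow_of_nonpos (by positivity) ?_ (by linarith)
    rw [div_pow, div_div_eq_mul_div, le_div_iff₀ (by positivity)]
    nlinarith
  simp only [rieszBessel]
  rw [e1, mul_add, Real.rpow_add ht]
  calc _ = c * |a| ^ (-2 * α) * (a / b) ^ (2 * α) * ((1 + a ^ 2) ^ (-β) * (a / b) ^ (2 * β)) := by
        ring
    _ ≤ c * |a| ^ (-2 * α) * (a / b) ^ (2 * α) * (1 + b ^ 2) ^ (-β) := by gcongr
    _ = _ := by ring

lemma rieszBessel_antitone {c α β a b : ℝ} (hc : 0 ≤ c) (hα : 0 ≤ α) (hβ : 0 ≤ β) (ha : 0 < a)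
    (hab : a ≤ b) : rieszBessel c α β b ≤ rieszBessel c α β a := by
  have hb : 0 < b := ha.trans_le hab
  simp only [rieszBessel, abs_of_pos ha, abs_of_pos hb]
  have h1 : b ^ (-2 * α) ≤ a ^ (-2 * α) := Real.rpow_le_rpow_of_nonpos ha hab (by linarith)
  have h2 : (1 + b ^ 2) ^ (-β) ≤ (1 + a ^ 2) ^ (-β) :=
    Real.rpow_le_rpow_of_nonpos (by positivity) (by nlinarith) (by linarith)
  gcongr

/-- Increments of `rieszBessel` between positive points, at the scale `d`. -/
lemma rieszBessel_sub_le {c α β a b d : ℝ} (hc : 0 ≤ c) (hβ : 0 ≤ β) (ha : 0 < a)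
    (hab : a ≤ b) (hd : 0 < d) (hbd : b - a ≤ d) :
    rieszBessel c α β a - rieszBessel c α β b ≤
      2 * c * max 1 (2 * (α + β)) * d ^ (-2 * α) * rieszBessel 1 α (1 / 2) (d⁻¹ * a) := by
  have hb : 0 < b := ha.trans_le hab
  have ht : 0 < a / b := by positivity
  have ht1 : a / b ≤ 1 := (div_le_one hb).2 hab
  set K := max 1 (2 * (α + β)) with hK
  have hK0 : 0 < K := lt_of_lt_of_le one_pos (le_max_left _ _)
  have hFa : rieszBessel c α β a ≤ c * a ^ (-2 * α) := by
    simp only [rieszBessel, abs_of_pos ha]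
    refine mul_le_of_le_one_right (by positivity) ?_
    exact Real.rpow_le_one_of_one_le_of_nonpos (by nlinarith) (by linarith)
  have hF0 : 0 ≤ rieszBessel c α β a := by simp only [rieszBessel]; positivity
  have h1 : rieszBessel c α β a - rieszBessel c α β b ≤ c * a ^ (-2 * α) * (K * (1 - a / b)) := by
    calc _ ≤ rieszBessel c α β a - rieszBessel c α β a * (a / b) ^ (2 * (α + β)) := by
          linarith [rieszBessel_mul_rpow_le (α := α) hc hβ ha hab]
      _ = rieszBessel c α β a * (1 - (a / b) ^ (2 * (α + β))) := by ring
      _ ≤ rieszBessel c α β a * (K * (1 - a / b)) := by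
          gcongr
          exact one_sub_rpow_le ht ht1
      _ ≤ _ := by
          refine mul_le_mul_of_nonneg_right hFa (mul_nonneg hK0.le (by linarith))
  set z := d⁻¹ * a with hz
  have hz0 : 0 < z := by positivity
  -- From b - a ≤ d one gets 1 - a/b ≤ 2d/(d + a) = 2/(1 + z), and √(1 + z²) ≤ 1 + z. This extra
  -- decay of order 1/z makes the profile p-integrable at infinity.
  have h2 : 1 - a / b ≤ 2 * (1 + z ^ 2) ^ (-(1 / 2) : ℝ) := by
    have h3 : 1 - a / b ≤ 2 / (1 + z) := by
      have e : 2 / (1 + z) = 2 * d / (d + a) := by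
        rw [hz]; field_simp
      rw [e, one_sub_div hb.ne', div_le_div_iff₀ hb (by positivity)]
      nlinarith
    refine h3.trans ?_
    rw [Real.rpow_neg (by positivity), ← Real.sqrt_eq_rpow, div_eq_mul_inv]
    gcongr
    rw [Real.sqrt_le_left (by positivity)]
    nlinarith
  have h4 : a ^ (-2 * α) = d ^ (-2 * α) * z ^ (-2 * α) := by
    rw [← Real.mul_rpow hd.le hz0.le, hz, mul_inv_cancel_left₀ hd.ne']
  refine h1.trans ?_
  simp only [rieszBessel, abs_of_pos hz0]
  rw [h4]
  calc _ ≤ c * (d ^ (-2 * α) * z ^ (-2 * α)) * (K * (2 * (1 + z ^ 2) ^ (-(1 / 2) : ℝ))) := by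
        gcongr
    _ = _ := by ring

/-- By evenness only |x| and |x + u| matter, and they differ by at most u. The point nearer the
origin supplies the bound; the sum covers both cases. -/
lemma abs_rieszBessel_increment_le {c α β u x : ℝ} (hc : 0 ≤ c) (hα : 0 ≤ α) (hβ : 0 ≤ β)
    (hu : 0 < u) (hx : x ≠ 0) (hxu : x + u ≠ 0) :
    |rieszBessel c α β (x + u) - rieszBessel c α β x| ≤
      2 * c * max 1 (2 * (α + β)) * u ^ (-2 * α) * (rieszBessel 1 α (1 / 2) (u⁻¹ * x) +
        rieszBessel 1 α (1 / 2) (u⁻¹ * (x + u))) := by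
  have key : ∀ y w : ℝ, y ≠ 0 → |y| ≤ |w| → |w| - |y| ≤ u →
      |rieszBessel c α β w - rieszBessel c α β y| ≤
      2 * c * max 1 (2 * (α + β)) * u ^ (-2 * α) * rieszBessel 1 α (1 / 2) (u⁻¹ * y) := by
    intro y w hy hyw hwy
    have hy' : 0 < |y| := abs_pos.2 hy
    have h1 := rieszBessel_sub_le (c := c) (α := α) (β := β) hc hβ hy' hyw hu hwy
    have h2 := rieszBessel_antitone (c := c) (α := α) (β := β) hc hα hβ hy' hyw
    have e : rieszBessel 1 α (1 / 2) (u⁻¹ * |y|) = rieszBessel 1 α (1 / 2) (u⁻¹ * y) := by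
      rw [← rieszBessel_abs _ _ _ (u⁻¹ * y), abs_mul, abs_of_pos (inv_pos.2 hu)]
    rw [rieszBessel_abs, rieszBessel_abs] at h1 h2
    rw [e] at h1
    rwa [abs_sub_comm, abs_of_nonneg (by linarith)]
  have hpos : ∀ y, 0 ≤ rieszBessel 1 α (1 / 2) y := fun y => by
    simp only [rieszBessel]; positivity
  have hK : 0 ≤ 2 * c * max 1 (2 * (α + β)) * u ^ (-2 * α) := by positivity
  have hd1 := abs_sub_abs_le_abs_sub (x + u) x
  have hd2 := abs_sub_abs_le_abs_sub x (x + u)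
  have e1 : |x + u - x| = u := by rw [add_sub_cancel_left, abs_of_pos hu]
  rw [abs_sub_comm x] at hd2
  rw [e1] at hd1 hd2
  rw [mul_add]
  rcases le_total |x| |x + u| with h | h
  · refine (key x (x + u) hx h hd1).trans ?_
    exact le_add_of_nonneg_right (mul_nonneg hK (hpos _))
  · rw [abs_sub_comm]
    refine (key (x + u) x hxu h hd2).trans ?_
    exact le_add_of_nonneg_left (mul_nonneg hK (hpos _))

lemma eLpNorm_comp_mul_left_real {F : ℝ → ℝ} (hF : Measurable F) {T ρ : ℝ} (hT : 0 < T)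
    (hρ : 0 < ρ) : eLpNorm (fun x => F (T * x)) (ENNReal.ofReal ρ) volume =
      ENNReal.ofReal (T⁻¹ ^ (1 / ρ)) * eLpNorm F (ENNReal.ofReal ρ) volume := by
  have h0 : ENNReal.ofReal ρ ≠ 0 := by simpa using hρ
  rw [eLpNorm_eq_lintegral_rpow_enorm_toReal h0 ENNReal.ofReal_ne_top,
    eLpNorm_eq_lintegral_rpow_enorm_toReal h0 ENNReal.ofReal_ne_top, ENNReal.toReal_ofReal hρ.le,
    lintegral_comp_mul_left_real (F := fun x => ‖F x‖ₑ ^ ρ) (hF.enorm.pow_const _) hT,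
    ENNReal.mul_rpow_of_nonneg _ _ (by positivity),
    ENNReal.ofReal_rpow_of_pos (inv_pos.2 hT)]

lemma exists_eLpNorm_rieszBessel_increment_le {c α β ρ : ℝ} (hc : 0 ≤ c) (hα : 0 < α) (hβ : 0 ≤ β)
    (hρ : 1 ≤ ρ) (hαρ : 2 * α * ρ < 1) :
    ∃ C : ℝ≥0, ∀ u : ℝ, 0 < u →
      eLpNorm (fun x => rieszBessel c α β (x + u) - rieszBessel c α β x) (ENNReal.ofReal ρ) volume ≤
        C * ENNReal.ofReal (u ^ (1 / ρ - 2 * α)) := by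
  have hρ0 : 0 < ρ := by linarith
  set R := rieszBessel 1 α (1 / 2) with hR
  have hRm : Measurable R := measurable_rieszBessel _ _ _
  -- R lies in L^ρ at the origin because 2αρ < 1, and at infinity because (2α + 1)ρ > 1. Dilation by
  -- u⁻¹ then contributes u^{1/ρ}, to be combined with u^{-2α}.
  have hRL : MemLp R (ENNReal.ofReal ρ) volume :=
    memLp_rieszBessel zero_le_one (by norm_num) hρ hαρ (by nlinarith [mul_pos hα hρ0])
  set K := 2 * c * max 1 (2 * (α + β)) with hK
  have hK0 : 0 ≤ K := by positivity
  refine ⟨K.toNNReal * (2 * (eLpNorm R (ENNReal.ofReal ρ) volume).toNNReal), fun u hu => ?_⟩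
  have hae : ∀ᵐ x : ℝ, ‖rieszBessel c α β (x + u) - rieszBessel c α β x‖ ≤
      ‖(K * u ^ (-2 * α)) • (R (u⁻¹ * x) + R (u⁻¹ * (x + u)))‖ := by
    filter_upwards [(measure_singleton (0 : ℝ) : volume {(0 : ℝ)} = 0) |> compl_mem_ae_iff.2,
      (measure_singleton (-u : ℝ) : volume {(-u : ℝ)} = 0) |> compl_mem_ae_iff.2] with x h1 h2
    have h2' : x + u ≠ 0 := fun h => h2 (by simp; linarith)
    refine (abs_rieszBessel_increment_le hc hα.le hβ hu h1 h2').trans (le_abs_self _)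
  have hS : Measurable fun x => R (u⁻¹ * x) := hRm.comp (measurable_const_mul _)
  have hS' : Measurable fun x => R (u⁻¹ * (x + u)) := hS.comp (measurable_add_const u)
  have hρ1 : 1 ≤ ENNReal.ofReal ρ := by simpa using hρ
  have e2 : ENNReal.ofReal (u ^ (1 / ρ - 2 * α)) =
      ENNReal.ofReal (u ^ (-2 * α)) * ENNReal.ofReal (u ^ (1 / ρ)) := by
    rw [← ENNReal.ofReal_mul (by positivity), ← Real.rpow_add hu]
    congr 2; ring
  have e3 : eLpNorm (fun x => R (u⁻¹ * x)) (ENNReal.ofReal ρ) volume =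
      ENNReal.ofReal (u ^ (1 / ρ)) * eLpNorm R (ENNReal.ofReal ρ) volume := by
    rw [eLpNorm_comp_mul_left_real hRm (inv_pos.2 hu) hρ0, inv_inv]
  refine (eLpNorm_mono_ae hae).trans ?_
  calc _ = ‖K * u ^ (-2 * α)‖ₑ * eLpNorm ((fun x => R (u⁻¹ * x)) + fun x => R (u⁻¹ * (x + u)))
        (ENNReal.ofReal ρ) volume := eLpNorm_const_smul _ _ _ _
    _ ≤ ‖K * u ^ (-2 * α)‖ₑ * (eLpNorm (fun x => R (u⁻¹ * x)) (ENNReal.ofReal ρ) volume +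
        eLpNorm (fun x => R (u⁻¹ * (x + u))) (ENNReal.ofReal ρ) volume) := by
        gcongr
        exact eLpNorm_add_le hS.aestronglyMeasurable hS'.aestronglyMeasurable hρ1
    _ = _ := by
        rw [eLpNorm_comp_add_right _ hS u, e3, e2, Real.enorm_of_nonneg (by positivity),
          ENNReal.ofReal_mul hK0]
        push_cast
        rw [ENNReal.coe_toNNReal hRL.eLpNorm_ne_top, ← ENNReal.ofReal]
        ring

/-! ### Lipschitz symbols -/

/-- A modulus of continuity of order `γ` for small positive increments extends to all
increments. -/
lemma exists_eLpNorm_increment_le {h : ℝ → ℝ} {p : ℝ≥0∞} {γ δ : ℝ} (hp : 1 ≤ p) (hγ : 0 ≤ γ)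
    (hδ : 0 < δ) (hh : Measurable h) (hh2 : eLpNorm h p volume ≠ ∞) {C : ℝ≥0}
    (hC : ∀ u : ℝ, 0 < u → u < δ → eLpNorm (fun x => h (x + u) - h x) p volume ≤
      C * ENNReal.ofReal (u ^ γ)) :
    ∃ C : ℝ≥0, ∀ u : ℝ, eLpNorm (fun x => h (x + u) - h x) p volume ≤
      C * ENNReal.ofReal (|u| ^ γ) := by
  have hm : ∀ u, Measurable fun x => h (x + u) := fun u => hh.comp (measurable_add_const u)
  set N := eLpNorm h p volume with hN
  refine ⟨C + 2 * N.toNNReal * (δ ^ (-γ)).toNNReal, ?_⟩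
  have hpos : ∀ u : ℝ, 0 < u → eLpNorm (fun x => h (x + u) - h x) p volume ≤
      ((C + 2 * N.toNNReal * (δ ^ (-γ)).toNNReal : ℝ≥0) : ℝ≥0∞) * ENNReal.ofReal (u ^ γ) := by
    intro u hu
    push_cast
    rw [ENNReal.coe_toNNReal hh2, ← ENNReal.ofReal, add_mul]
    by_cases hud : u < δ
    · exact (hC u hu hud).trans (le_add_of_nonneg_right zero_le)
    · push Not at hud
      refine le_trans ?_ (le_add_of_nonneg_left zero_le)
      -- For u ≥ δ the trivial bound 2‖h‖ suffices, since (u/δ)^γ ≥ 1.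
      calc _ ≤ eLpNorm (fun x => h (x + u)) p volume + eLpNorm h p volume :=
            eLpNorm_sub_le (hm u).aestronglyMeasurable hh.aestronglyMeasurable hp
        _ = 2 * N * 1 := by rw [eLpNorm_comp_add_right p hh, mul_one, two_mul]
        _ ≤ 2 * N * (ENNReal.ofReal (δ ^ (-γ)) * ENNReal.ofReal (u ^ γ)) := by
            gcongr
            rw [← ENNReal.ofReal_mul (by positivity), ENNReal.one_le_ofReal, Real.rpow_neg hδ.le,
              inv_mul_eq_div, one_le_div (by positivity)]
            gcongr
        _ = _ := by ring
  intro u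
  rcases lt_trichotomy u 0 with hu | rfl | hu
  · rw [abs_of_neg hu]
    -- Translation by u turns the increment by -u into minus the increment by u, so the norms agree.
    refine le_trans (le_of_eq ?_) (hpos (-u) (by linarith))
    have hd : Measurable fun x => h (x + -u) - h x := (hm _).sub hh
    rw [← eLpNorm_comp_add_right p hd u, ← eLpNorm_neg]
    refine eLpNorm_congr_ae (Eventually.of_forall fun x => ?_)
    simp
  · simp
  · rw [abs_of_pos hu]
    exact hpos u hu

lemma lipSymbol_rieszBessel {c α β ρ γ : ℝ} (hc : 0 ≤ c) (hα : 0 < α) (hβ : 0 ≤ β)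
    (hρ : 1 ≤ ρ) (hαρ : 2 * α * ρ < 1) (hα1 : 2 * α < 1) (hαβ : 1 < 2 * (α + β)) (hγ : 0 ≤ γ)
    (hγρ : γ ≤ 1 / ρ - 2 * α) : LipSymbol γ (rieszBessel c α β) (ENNReal.ofReal ρ) := by
  have hL : MemLp (rieszBessel c α β) (ENNReal.ofReal ρ) volume :=
    memLp_rieszBessel hc hβ hρ hαρ (by nlinarith)
  have hI : MemLp (rieszBessel c α β) (ENNReal.ofReal 1) volume :=
    memLp_rieszBessel hc hβ le_rfl (by linarith) (by linarith)
  obtain ⟨C, hC⟩ := exists_eLpNorm_rieszBessel_increment_le (c := c) (β := β) hc hα hβ hρ hαρ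
  refine ⟨measurable_rieszBessel _ _ _, ?_, hL.eLpNorm_ne_top, ?_⟩
  · rwa [ENNReal.ofReal_one, memLp_one_iff_integrable] at hI
  · refine exists_eLpNorm_increment_le (by simpa using hρ) hγ one_pos
      (measurable_rieszBessel _ _ _) hL.eLpNorm_ne_top (C := C) fun u hu hu1 => ?_
    refine (hC u hu).trans ?_
    exact mul_le_mul_right (ENNReal.ofReal_le_ofReal
      (Real.rpow_le_rpow_of_exponent_ge hu hu1.le hγρ)) _

lemma MemLip.lipSymbol {g g' : ℝ → ℝ} {q : ℝ≥0∞} {γ : ℝ} (hq : 1 ≤ q) (hγ : 0 ≤ γ)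
    (hg : Integrable g) (hL : MemLip q γ g) (hg' : Measurable g') (hgg : g =ᵐ[volume] g') :
    LipSymbol γ g' q := by
  have hn : eLpNorm g' q volume ≠ ∞ := by
    rw [← eLpNorm_congr_ae hgg]
    exact hL.1.eLpNorm_ne_top
  refine ⟨hg', hg.congr hgg, hn, ?_⟩
  obtain ⟨C, hC⟩ := hL.2
  obtain ⟨δ, hδ, hδC⟩ := mem_nhdsGT_iff_exists_Ioo_subset.1 hC
  refine exists_eLpNorm_increment_le hq hγ hδ hg' hn (C := C) fun u hu hud => ?_
  refine le_trans ?_ (hδC ⟨hu, hud⟩)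
  have hae : (fun x => g' (x + u) - g' x) =ᵐ[volume] fun x => g (x + u) - g x := by
    have := (measurePreserving_add_right volume u).quasiMeasurePreserving.ae_eq_comp hgg
    filter_upwards [this, hgg] with x h1 h2
    simp only [Function.comp_apply] at h1
    rw [h1, h2]
  rw [eLpNorm_congr_ae hae]
  exact le_iSup₂ (f := fun v (_ : v ∈ Set.Ioc 0 u) =>
    eLpNorm (fun x => g (x + v) - g x) q volume) u ⟨hu, le_rfl⟩

lemma toeplitzOp_congr_ae {g g' : ℝ → ℝ} (h : g =ᵐ[volume] g') (T : ℝ) :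
    toeplitzOp T g = toeplitzOp T g' := by
  have hF : fourierTr g = fourierTr g' := by
    funext t
    refine integral_congr_ae ?_
    filter_upwards [h] with l hl
    rw [hl]
  refine ContinuousLinearMap.ext fun u => Lp.ext ?_
  filter_upwards [toeplitzOp_apply T g u, toeplitzOp_apply T g' u] with t h1 h2
  rw [h1, h2, hF]

/-! ### The alternating product and its trace error -/

/-- The symbols of `[W_T(f) W_T(g)]^{k+1}` after the leading factor `W_T(f)`. -/
def alternatingSymbols (f g : ℝ → ℝ) (p q : ℝ≥0∞) (k : ℕ) : List ((ℝ → ℝ) × ℝ≥0∞) :=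
  (g, q) :: (List.replicate k [(f, p), (g, q)]).flatten

lemma length_alternatingSymbols (f g : ℝ → ℝ) (p q : ℝ≥0∞) (k : ℕ) :
    (alternatingSymbols f g p q k).length = 2 * k + 1 := by
  simp [alternatingSymbols]
  ring

lemma eq_or_eq_of_mem_alternatingSymbols {f g : ℝ → ℝ} {p q : ℝ≥0∞} {k : ℕ}
    {a : (ℝ → ℝ) × ℝ≥0∞} (ha : a ∈ alternatingSymbols f g p q k) : a = (f, p) ∨ a = (g, q) := by
  simp only [alternatingSymbols, List.mem_cons, List.mem_flatten, List.mem_replicate] at ha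
  rcases ha with h | ⟨l, ⟨-, rfl⟩, h⟩
  · exact Or.inr h
  · simpa using h

lemma sum_inv_alternatingSymbols (f g : ℝ → ℝ) (p q : ℝ≥0∞) (k : ℕ) :
    p⁻¹ + ((alternatingSymbols f g p q k).map fun a => a.2⁻¹).sum = (k + 1 : ℕ) * (p⁻¹ + q⁻¹) := by
  have h : ∀ k : ℕ, (((List.replicate k [(f, p), (g, q)]).flatten).map fun a => a.2⁻¹).sum =
      k * (p⁻¹ + q⁻¹) := by
    intro k
    induction k with
    | zero => simp
    | succ k ih =>
      rw [List.replicate_succ, List.flatten_cons, List.map_append, List.sum_append, ih]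
      simp only [List.map_cons, List.map_nil, List.sum_cons, List.sum_nil, add_zero]
      push_cast
      ring
  rw [alternatingSymbols, List.map_cons, List.sum_cons, h]
  push_cast
  ring

lemma mul_prod_alternatingSymbols (f g : ℝ → ℝ) (p q : ℝ≥0∞) (k : ℕ) (x : ℝ) :
    f x * ((alternatingSymbols f g p q k).map fun a => a.1 x).prod = (f x * g x) ^ (k + 1) := by
  have h : (((List.replicate k [(f, p), (g, q)]).flatten).map fun a => a.1 x).prod =
      (f x * g x) ^ k := by
    induction k with
    | zero => simp
    | succ k ih =>
      rw [List.replicate_succ, List.flatten_cons, List.map_append, List.prod_append, ih, pow_succ']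
      simp
  rw [alternatingSymbols, List.map_cons, List.prod_cons, h]
  ring

lemma toeplitzOp_mul_toeplitzListProd (f g : ℝ → ℝ) (p q : ℝ≥0∞) (k : ℕ) (T : ℝ) :
    toeplitzOp T f * toeplitzListProd T (alternatingSymbols f g p q k) =
      toeplitzProd (k + 1) f g T := by
  have h : toeplitzListProd T (List.replicate k [(f, p), (g, q)]).flatten =
      (toeplitzOp T f * toeplitzOp T g) ^ k := by
    induction k with
    | zero => simp [toeplitzListProd]
    | succ k ih =>
      rw [toeplitzListProd] at ih ⊢
      rw [List.replicate_succ, List.flatten_cons, List.map_append, List.prod_append, ih, pow_succ']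
      simp
  rw [toeplitzProd, pow_succ', ← h]
  simp only [toeplitzListProd, alternatingSymbols, List.map_cons, List.prod_cons]
  rw [mul_assoc]

lemma integrable_mul_pow {f g : ℝ → ℝ} {p q : ℝ≥0∞} {ν : ℕ} (hν : ν ≠ 0) (hf : MemLp f p volume)
    (hg : MemLp g q volume) (hpq : p⁻¹ + q⁻¹ = (ν : ℝ≥0∞)⁻¹) :
    Integrable fun x => (f x * g x) ^ ν := by
  have : ENNReal.HolderTriple p q ν := ⟨hpq⟩
  have h : MemLp (f • g) ν volume := hg.smul hf
  have h2 := h.integrable_norm_pow hν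
  refine h2.mono' (h.1.pow ν) (Eventually.of_forall fun x => ?_)
  rw [norm_pow]
  rfl

lemma HasTrace.toeplitzProd {f g : ℝ → ℝ} (hf : Integrable f) (p q : ℝ≥0∞) (k : ℕ) {T : ℝ}
    (hT : 0 ≤ T) : HasTrace (toeplitzProd (k + 1) f g T) (∫ x, (f x : ℂ) *
      inner ℂ (expVec T x) (toeplitzListProd T (alternatingSymbols f g p q k) (expVec T x))) := by
  rw [← toeplitzOp_mul_toeplitzListProd f g p q]
  exact hasTrace_toeplitzOp_mul hT hf _

lemma integrable_mul_inner_apply {T : ℝ} (hT : 0 ≤ T) {f : ℝ → ℝ} (hf : Integrable f)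
    (B : L2T T →L[ℂ] L2T T) :
    Integrable fun x => (f x : ℂ) * inner ℂ (expVec T x) (B (expVec T x)) := by
  refine hf.ofReal.mul_bdd (c := √T * (‖B‖ * √T)) ?_ (Eventually.of_forall fun x => ?_)
  · exact ((continuous_expVec hT).inner
      (B.continuous.comp (continuous_expVec hT))).aestronglyMeasurable
  · refine (norm_inner_le_norm _ _).trans ?_
    have := B.le_opNorm (expVec T x)
    rw [norm_expVec hT] at this ⊢
    gcongr

/-- The trace approximation for `[W_T(f) W_T(g)]^{k+1}` with symbols of class `Lip`. -/
lemma exists_traceError_le {γ : ℝ} (hγ : 0 ≤ γ) (hγ1 : γ < 1) {f g : ℝ → ℝ} {p q : ℝ≥0∞} {k : ℕ}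
    (hf : LipSymbol γ f p) (hg : LipSymbol γ g q) (hpq : p⁻¹ + q⁻¹ = ((k + 1 : ℕ) : ℝ≥0∞)⁻¹) :
    ∃ C : ℝ, ∀ T : ℝ, 0 < T → traceError (k + 1) f g T ≤ C * T ^ (-γ) := by
  set L := alternatingSymbols f g p q k with hL
  obtain ⟨C, hC⟩ := exists_lintegral_trace_sub_le hγ hγ1 L
    (fun a ha => by
      rcases eq_or_eq_of_mem_alternatingSymbols ha with rfl | rfl
      exacts [hf, hg]) f p hf.measurable hf.eLpNorm_ne_top (by
      -- The leading f has exponent p, so there are k + 1 pairs and (k + 1)(1/p + 1/q) = 1.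
      rw [sum_inv_alternatingSymbols, hpq]
      exact ENNReal.mul_inv_cancel (by simp) (ENNReal.natCast_ne_top _))
  refine ⟨C, fun T hT => ?_⟩
  have hI1 := integrable_mul_inner_apply hT.le hf.integrable (toeplitzListProd T L)
  have hI2 : Integrable fun x => (((2 * Real.pi) ^ (2 * k + 1) * T * (f x * g x) ^ (k + 1) : ℝ) : ℂ) :=
    ((integrable_mul_pow k.succ_ne_zero
      ⟨hf.measurable.aestronglyMeasurable, lt_top_iff_ne_top.2 hf.eLpNorm_ne_top⟩
      ⟨hg.measurable.aestronglyMeasurable, lt_top_iff_ne_top.2 hg.eLpNorm_ne_top⟩ hpq).const_mul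
        _).ofReal
  have hCT := hC T hT
  simp only [mul_prod_alternatingSymbols, hL, length_alternatingSymbols] at hCT
  have hbound : ‖∫ x, ((f x : ℂ) * inner ℂ (expVec T x) (toeplitzListProd T L (expVec T x)) -
      (((2 * Real.pi) ^ (2 * k + 1) * T * (f x * g x) ^ (k + 1) : ℝ) : ℂ))‖ ≤ C * T ^ (1 - γ) := by
    have h1 := (enorm_integral_le_lintegral_enorm _).trans hCT
    rw [← ofReal_norm, ← ENNReal.ofReal_coe_nnreal, ← ENNReal.ofReal_mul (by positivity)] at h1
    exact (ENNReal.ofReal_le_ofReal_iff (by positivity)).1 h1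
  have htr := (HasTrace.toeplitzProd (g := g) hf.integrable p q k hT.le).opTrace_eq
  have hTc : (T : ℂ) ≠ 0 := by exact_mod_cast hT.ne'
  have e : (1 / (T : ℂ)) * opTrace (toeplitzProd (k + 1) f g T)
      - (((2 * Real.pi) ^ (2 * (k + 1) - 1) * ∫ l : ℝ, (f l * g l) ^ (k + 1) : ℝ) : ℂ) =
      (1 / (T : ℂ)) * ∫ x, ((f x : ℂ) *
        inner ℂ (expVec T x) (toeplitzListProd T L (expVec T x)) -
        (((2 * Real.pi) ^ (2 * k + 1) * T * (f x * g x) ^ (k + 1) : ℝ) : ℂ)) := by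
    rw [integral_sub hI1 hI2, htr, integral_complex_ofReal, integral_const_mul, mul_sub]
    congr 1
    have : 2 * (k + 1) - 1 = 2 * k + 1 := by omega
    rw [this]
    push_cast
    field_simp
  rw [traceError, e, norm_mul]
  calc _ ≤ ‖1 / (T : ℂ)‖ * (C * T ^ (1 - γ)) := by gcongr
    _ = _ := by
      rw [norm_div, norm_one, Complex.norm_real, Real.norm_of_nonneg hT.le, sub_eq_add_neg,
        Real.rpow_add hT, Real.rpow_one]
      field_simp

/-! ### Choice of exponents and conclusion -/

/-- The exponent `ρ` complementary to `q`, chosen so that `1/ρ + 1/q = 1/ν`. -/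
lemma exists_complementary_exponent {ν : ℕ} (hν : 1 ≤ ν) {p : ℝ} {q : ℝ≥0∞} (hp : 1 ≤ p)
    (hq : 1 ≤ q) (hpq : 1 / p + (1 / q).toReal ≤ 1 / (ν : ℝ)) :
    ∃ ρ : ℝ, 1 ≤ ρ ∧ ρ ≤ p ∧ (ENNReal.ofReal ρ)⁻¹ + q⁻¹ = (ν : ℝ≥0∞)⁻¹ := by
  have hp0 : 0 < p := by linarith
  have hν0 : (1 : ℝ) ≤ ν := by exact_mod_cast hν
  rw [one_div q] at hpq
  set σ := (1 : ℝ) / ν - (q⁻¹).toReal with hσ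
  have hσp : 1 / p ≤ σ := by linarith
  have hσ0 : 0 < σ := lt_of_lt_of_le (by positivity) hσp
  have hσ1 : σ ≤ 1 := by
    have h1 : (1 : ℝ) / ν ≤ 1 := (div_le_one (by linarith)).2 hν0
    linarith [ENNReal.toReal_nonneg (a := q⁻¹)]
  have hqt : q⁻¹ ≠ ∞ := ENNReal.inv_ne_top.2 (by positivity)
  refine ⟨σ⁻¹, (one_le_inv₀ hσ0).2 hσ1, ?_, ?_⟩
  · rw [inv_le_comm₀ hσ0 hp0, ← one_div]
    exact hσp
  · rw [ENNReal.ofReal_inv_of_pos hσ0, inv_inv, ← ENNReal.ofReal_toReal hqt,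
      ← ENNReal.ofReal_add hσ0.le ENNReal.toReal_nonneg, hσ, sub_add_cancel, one_div,
      ENNReal.ofReal_inv_of_pos (by linarith), ENNReal.ofReal_natCast]
end TraceApprox

theorem theorem4p3 (ν : ℕ) (hν : 1 ≤ ν) (c α β p : ℝ) (q : ℝ≥0∞)
    (hc : 0 < c) (hβ : 0 < β) (hp : 1 ≤ p) (hq : 1 ≤ q)
    (hpq : 1 / p + (1 / q).toReal ≤ 1 / (ν : ℝ))
    (hα : 0 < α) (hαp : α < 1 / (2 * p)) (hαβ : 1 / 2 < α + β)
    (g : ℝ → ℝ) (hg : Integrable g volume) (hgsymm : ∀ l : ℝ, g (-l) = g l)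
    (hgLip : TraceApprox.MemLip q (1 / p - 2 * α) g) :
    Integrable (TraceApprox.rieszBessel c α β) volume ∧
    Integrable (fun l : ℝ => (TraceApprox.rieszBessel c α β l * g l) ^ ν) volume ∧
    (∀ T : ℝ, 0 < T → TraceApprox.IsTraceClass (TraceApprox.toeplitzProd ν (TraceApprox.rieszBessel c α β) g T)) ∧
    ∀ ε : ℝ, 0 < ε →
      (fun T : ℝ => TraceApprox.traceError ν (TraceApprox.rieszBessel c α β) g T)
        =O[atTop] (fun T : ℝ => T ^ (-(1 / p - 2 * α) + ε)) := by
  obtain ⟨ρ, hρ1, hρp, hρq⟩ := TraceApprox.exists_complementary_exponent hν hp hq hpq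
  obtain ⟨k, rfl⟩ : ∃ k, ν = k + 1 := ⟨ν - 1, by omega⟩
  have hρ0 : 0 < ρ := by linarith
  have hp0 : 0 < p := by linarith
  have hαp' : 2 * α * p < 1 := by
    rw [lt_div_iff₀ (by positivity)] at hαp
    linarith
  have hγ : 0 ≤ 1 / p - 2 * α := by
    rw [sub_nonneg, le_div_iff₀ hp0]
    exact hαp'.le
  have hγ1 : 1 / p - 2 * α < 1 := by
    have : 1 / p ≤ 1 := (div_le_one hp0).2 hp
    linarith
  have hαρ : 2 * α * ρ < 1 := lt_of_le_of_lt (by gcongr) hαp'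
  -- Lowering p to ρ costs nothing for the density: its order in L^ρ is 1/ρ - 2α, at least the
  -- required 1/p - 2α.
  have hf : TraceApprox.LipSymbol (1 / p - 2 * α) (TraceApprox.rieszBessel c α β)
      (ENNReal.ofReal ρ) :=
    TraceApprox.lipSymbol_rieszBessel hc.le hα hβ.le hρ1 hαρ (by nlinarith) (by linarith) hγ
      (sub_le_sub_right (one_div_le_one_div_of_le hρ0 hρp) _)
  -- The kernel bounds need a Borel measurable symbol. Passing to a representative changes neither
  -- the Toeplitz operator nor the limit integral.
  set g' := hg.1.mk g with hg'
  have hgg : g =ᵐ[volume] g' := hg.1.ae_eq_mk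
  have hgl : TraceApprox.LipSymbol (1 / p - 2 * α) g' q :=
    hgLip.lipSymbol hq hγ hg hg.1.stronglyMeasurable_mk.measurable hgg
  have hprod : ∀ T, TraceApprox.toeplitzProd (k + 1) (TraceApprox.rieszBessel c α β) g T =
      TraceApprox.toeplitzProd (k + 1) (TraceApprox.rieszBessel c α β) g' T := fun T => by
    rw [TraceApprox.toeplitzProd, TraceApprox.toeplitzOp_congr_ae hgg, TraceApprox.toeplitzProd]
  refine ⟨hf.integrable, ?_, fun T hT => ?_, fun ε hε => ?_⟩
  · exact TraceApprox.integrable_mul_pow k.succ_ne_zero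
      ⟨hf.measurable.aestronglyMeasurable, lt_top_iff_ne_top.2 hf.eLpNorm_ne_top⟩ hgLip.1 hρq
  · exact ⟨_, TraceApprox.HasTrace.toeplitzProd hf.integrable 1 1 k hT.le⟩
  · obtain ⟨C, hC⟩ := TraceApprox.exists_traceError_le hγ hγ1 hf hgl hρq
    refine IsBigO.of_bound |C| ?_
    filter_upwards [eventually_ge_atTop (1 : ℝ)] with T hT
    have hT0 : 0 < T := by linarith
    have he : TraceApprox.traceError (k + 1) (TraceApprox.rieszBessel c α β) g T =
        TraceApprox.traceError (k + 1) (TraceApprox.rieszBessel c α β) g' T := by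
      have hi : ∫ l, (TraceApprox.rieszBessel c α β l * g l) ^ (k + 1) =
          ∫ l, (TraceApprox.rieszBessel c α β l * g' l) ^ (k + 1) := by
        refine integral_congr_ae ?_
        filter_upwards [hgg] with l hl
        rw [hl]
      rw [TraceApprox.traceError, hprod, hi, TraceApprox.traceError]
    have hn : 0 ≤ TraceApprox.traceError (k + 1) (TraceApprox.rieszBessel c α β) g' T :=
      norm_nonneg _
    rw [he, Real.norm_of_nonneg hn, Real.norm_of_nonneg (by positivity)]
    calc _ ≤ C * T ^ (-(1 / p - 2 * α)) := hC T hT0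
      _ ≤ |C| * T ^ (-(1 / p - 2 * α)) := by
          gcongr
          exact le_abs_self C
      -- The bound already holds with exponent -γ; for T ≥ 1 adding ε only weakens it.
      _ ≤ |C| * T ^ (-(1 / p - 2 * α) + ε) := by
          gcongr
          linarith
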